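/- Let $\mathbb K$ be an algebraically closed field of characteristic $0$, let $V=\mathbb K^{N+1}$ and $\mathbb P^N=\mathbb P(V)$, and write $\hat r\subset V$ for the $2$-dimensional linear subspace corresponding to a line $r\subset\mathbb P^N$. Let $B\subset\mathbb G(1,N)$ be an irreducible closed subvariety of dimension $n\le N-2$ of the Grassmannian of lines of $\mathbb P^N$, and suppose that the union $X\subset\mathbb P^N$ of the lines of $B$ has dimension $n+1$. For $r\in B$ regard the tangent space $T_rB$ as a linear subspace of $T_r\mathbb G(1,N)=\operatorname{Hom}(\hat r,V/\hat r)$. The characteristic map $\chi(r)\colon T_rB\otimes\mathcal O_r\to (V/\hat r)\otimes\mathcal O_r(1)$ sends $\eta$ to $\eta(v)$ at the point $[v]\in r$; the focal locus on $r$ is the closed subscheme of $r\cong\mathbb P^1$ where $\chi(r)$ does not have maximal rank, defined by the maximal minors of $\chi(r)$. The fixed tangent space of $X$ along $r$ is the largest linear subspace of $\mathbb P^N$ contained in the embedded (Zariski) tangent spaces $\mathbb T_xX$ for all $x\in r$, i.e. $\bigcap_{x\in r}\mathbb T_xX$. A property holds for the general $r\in B$ if it holds for all $r$ in some nonempty Zariski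 open subset of $B$. Then, for every integer $k$ with $0\le k\le n$, the following are equivalent: (i) for the general $r\in B$, the focal locus on $r$ is a finite scheme of length $k$; (ii) for the general $r\in B$, the fixed tangent space of $X$ along $r$ is a $\mathbb P^{k+1}$, i.e. it has dimension exactly $k+1$. -/

import Mathlib

open MvPolynomial Filter Module

noncomputable section

/-- The Zariski tangent space at `x` of an affine cone `C ⊆ K^σ`: the common kernel of the
differentials at `x` of all polynomials vanishing on `C`. When `C` is the affine cone over a
projective variety and `x ≠ 0`, its projectivization is the embedded tangent space at `[x]`. -/
def affineTangent {K : Type*} [Field K] {σ : Type*} [Fintype σ]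
    (C : Set (σ → K)) (x : σ → K) : Submodule K (σ → K) where
  carrier := {v | ∀ F ∈ vanishingIdeal K C, ∑ i, eval x (pderiv i F) * v i = 0}
  zero_mem' := by
    intro F _
    simp
  add_mem' := by
    intro v w hv hw F hF
    simp only [Pi.add_apply, mul_add, Finset.sum_add_distrib, hv F hF, hw F hF, add_zero]
  smul_mem' := by
    intro c v hv F hF
    have h : ∑ i, eval x (pderiv i F) * (c • v) i = c * ∑ i, eval x (pderiv i F) * v i := by
      rw [Finset.mul_sum]
      refine Finset.sum_congr rfl fun i _ => ?_
      simp only [Pi.smul_apply, smul_eq_mul]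
      ring
    rw [h, hv F hF, mul_zero]

/-- The projective variety with affine cone `C` has dimension `d`: the coordinate ring of the cone
(that is, the homogeneous coordinate ring of the projective variety) has transcendence degree
`d + 1` over `K`. -/
def HasProjectiveDim (K : Type*) [Field K] {σ : Type*} (C : Set (σ → K)) (d : ℕ) : Prop :=
  Algebra.trdeg K (MvPolynomial σ K ⧸ vanishingIdeal K C) = ((d + 1 : ℕ) : Cardinal)

/-- The lines of `ℙ^N = ℙ(K^(N+1))`, i.e. the points of the Grassmannian `𝔾(1,N) = G(2,N+1)`. -/
structure ProjLine (K : Type*) [Field K] (N : ℕ) where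
  /-- The two-dimensional linear subspace of `K^(N+1)` whose projectivization is the line. -/
  hat : Submodule K (Fin (N + 1) → K)
  finrank_hat : finrank K hat = 2

/-- The Plücker coordinates `p_ij = u_i v_j - u_j v_i` of `u ∧ v`. -/
def plucker {K : Type*} [Field K] {N : ℕ} (u v : Fin (N + 1) → K) :
    Fin (N + 1) × Fin (N + 1) → K :=
  fun ij => u ij.1 * v ij.2 - u ij.2 * v ij.1

namespace ProjLine

variable {K : Type*} [Field K] {N : ℕ}

/-- The Plücker vector of a line, computed in a basis of the corresponding plane of `K^(N+1)`; a
change of basis multiplies it by a nonzero scalar. -/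
def pluckerVec (r : ProjLine K N) (b : Basis (Fin 2) K r.hat) : Fin (N + 1) × Fin (N + 1) → K :=
  plucker (b 0 : Fin (N + 1) → K) (b 1 : Fin (N + 1) → K)

/-- The Zariski topology of the Grassmannian in its Plücker embedding: a base of open sets is given
by the non-vanishing loci of homogeneous polynomials in the Plücker coordinates. -/
instance zariskiTopology : TopologicalSpace (ProjLine K N) :=
  TopologicalSpace.generateFrom
    {U | ∃ (d : ℕ) (F : MvPolynomial (Fin (N + 1) × Fin (N + 1)) K), F.IsHomogeneous d ∧
      U = {r | ∀ b : Basis (Fin 2) K r.hat, eval (r.pluckerVec b) F ≠ 0}}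

/-- The affine cone (without its vertex) over a set of lines in the Plücker embedding. -/
def pluckerCone (B : Set (ProjLine K N)) : Set (Fin (N + 1) × Fin (N + 1) → K) :=
  {w | ∃ r ∈ B, ∃ b : Basis (Fin 2) K r.hat, w = r.pluckerVec b}

/-- The affine cone over the union in `ℙ^N` of the lines of `B`. -/
def unionCone (B : Set (ProjLine K N)) : Set (Fin (N + 1) → K) :=
  {x | ∃ r ∈ B, x ∈ r.hat}

/-- The linear maps `ℓ : r̂ → V = K^(N+1)` such that the first order deformation
`u ↦ u + ε ℓ(u)` of `r̂` is tangent to `B`: for a basis `b` of `r̂`, the derivative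
`ℓ(b₀) ∧ b₁ + b₀ ∧ ℓ(b₁)` of the Plücker vector is tangent to the Plücker cone of `B`. -/
def tangentLifts (B : Set (ProjLine K N)) (r : ProjLine K N) :
    Submodule K (r.hat →ₗ[K] (Fin (N + 1) → K)) where
  carrier := {ℓ | ∀ b : Basis (Fin 2) K r.hat,
    plucker (ℓ (b 0)) (b 1) + plucker (b 0) (ℓ (b 1)) ∈
      affineTangent (pluckerCone B) (r.pluckerVec b)}
  zero_mem' := by
    intro b
    have h : plucker ((0 : r.hat →ₗ[K] (Fin (N + 1) → K)) (b 0)) (b 1) +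
        plucker (b 0) ((0 : r.hat →ₗ[K] (Fin (N + 1) → K)) (b 1)) = 0 := by
      funext ij
      simp [plucker]
    rw [h]
    exact zero_mem _
  add_mem' := by
    intro ℓ m hℓ hm b
    have h : plucker ((ℓ + m) (b 0)) (b 1) + plucker (b 0) ((ℓ + m) (b 1)) =
        (plucker (ℓ (b 0)) (b 1) + plucker (b 0) (ℓ (b 1))) +
        (plucker (m (b 0)) (b 1) + plucker (b 0) (m (b 1))) := by
      funext ij
      simp only [plucker, LinearMap.add_apply, Pi.add_apply]
      ring
    rw [h]
    exact add_mem (hℓ b) (hm b)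
  smul_mem' := by
    intro c ℓ hℓ b
    have h : plucker ((c • ℓ) (b 0)) (b 1) + plucker (b 0) ((c • ℓ) (b 1)) =
        c • (plucker (ℓ (b 0)) (b 1) + plucker (b 0) (ℓ (b 1))) := by
      funext ij
      simp only [plucker, LinearMap.smul_apply, Pi.smul_apply, Pi.add_apply, smul_eq_mul]
      ring
    rw [h]
    exact Submodule.smul_mem _ c (hℓ b)

/-- The tangent space `T_r B`, as a linear subspace of `T_r 𝔾(1,N) = Hom(r̂, V/r̂)`. -/
def tangentSpace (B : Set (ProjLine K N)) (r : ProjLine K N) :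
    Submodule K (r.hat →ₗ[K] ((Fin (N + 1) → K) ⧸ r.hat)) :=
  (tangentLifts B r).map (LinearMap.compRight K r.hat.mkQ)

/-- The square submatrix of size `m` of the characteristic map
`χ(r) : T_r B ⊗ 𝒪_r → V/r̂ ⊗ 𝒪_r(1)`, which sends `η` to `η(v)` at the point `[v]` of `r`,
cut out by tangent vectors `η_j` and linear forms `φ_i` on `V/r̂`. Its entries are linear forms in
the homogeneous coordinates `x₀, x₁` on `r` for which `[v] = [x₀ b₀ + x₁ b₁]`. -/
def charMatrix (r : ProjLine K N) (b : Basis (Fin 2) K r.hat) {m : ℕ}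
    (φ : Fin m → Dual K ((Fin (N + 1) → K) ⧸ r.hat))
    (η : Fin m → (r.hat →ₗ[K] ((Fin (N + 1) → K) ⧸ r.hat))) :
    Matrix (Fin m) (Fin m) (MvPolynomial (Fin 2) K) :=
  Matrix.of fun i j => ∑ a : Fin 2, C (φ i (η j (b a))) * X a

/-- The homogeneous ideal of the focal scheme on `r`, the locus where the rank of `χ(r)` is less
than the minimum of the ranks of its source and target: it is generated by the minors of `χ(r)` of
that order. -/
def focalIdeal (B : Set (ProjLine K N)) (r : ProjLine K N) (b : Basis (Fin 2) K r.hat) :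
    Ideal (MvPolynomial (Fin 2) K) :=
  Ideal.span {P | ∃ (φ : Fin (min (finrank K (tangentSpace B r))
        (finrank K ((Fin (N + 1) → K) ⧸ r.hat))) → Dual K ((Fin (N + 1) → K) ⧸ r.hat))
      (η : Fin (min (finrank K (tangentSpace B r))
        (finrank K ((Fin (N + 1) → K) ⧸ r.hat))) → (r.hat →ₗ[K] ((Fin (N + 1) → K) ⧸ r.hat))),
      (∀ j, η j ∈ tangentSpace B r) ∧ P = (charMatrix r b φ η).det}

/-- The value at `d` of the Hilbert function of `K[x₀, x₁] / I`. -/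
def hilbertFunction (I : Ideal (MvPolynomial (Fin 2) K)) (d : ℕ) : ℕ :=
  finrank K ((homogeneousSubmodule (Fin 2) K d).map (Ideal.Quotient.mkₐ K I).toLinearMap)

/-- The focal locus on `r` is a finite scheme of length `k`: the Hilbert polynomial of its
homogeneous ideal is the constant `k`. -/
def HasFocalLength (B : Set (ProjLine K N)) (r : ProjLine K N) (k : ℕ) : Prop :=
  ∀ b : Basis (Fin 2) K r.hat, ∀ᶠ d in atTop, hilbertFunction (focalIdeal B r b) d = k

/-- The linear subspace of `K^(N+1)` whose projectivization is the largest linear space contained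
in the embedded tangent spaces at all points of `r` to the union of the lines of `B`. -/
def fixedTangent (B : Set (ProjLine K N)) (r : ProjLine K N) : Submodule K (Fin (N + 1) → K) :=
  ⨅ x ∈ {x : Fin (N + 1) → K | x ∈ r.hat ∧ x ≠ 0}, affineTangent (unionCone B) x

/-- A property holds for a general line of the irreducible family `B`: it holds on a nonempty
Zariski open subset of `B`. -/
def ForGeneral (B : Set (ProjLine K N)) (P : ProjLine K N → Prop) : Prop :=
  ∃ U : Set (ProjLine K N), IsOpen U ∧ (U ∩ B).Nonempty ∧ ∀ r ∈ U ∩ B, P r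

end ProjLine

end

/-!
Let `X ⊆ ℙ(V)` be the union of the lines of `B`. The interior product `(s, w) ↦ s ⌟ w` maps the
product of the dual of `V` and the Plücker cone of `B` onto the cone over `X`, and it maps the
covectors onto `r̂` when `w` is a Plücker vector of `r`. In characteristic zero a dominant map is
generically smooth, so for the general `r ∈ B` and the general `x ∈ r̂` the tangent space of `X` at
`x` is the preimage in `V` of `{η x | η ∈ T_r B} ⊆ V/r̂`. As `dim X = dim B + 1`, the map
`η ↦ η x` is then injective on `T_r B`, and the fixed tangent space of `X` along `r` is the preimage
of the fixed space `F` of `χ(r)`, the set of the `y` which belong to `{η x | η ∈ T_r B}` for the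
general `x ∈ r̂`.

If `η x₀ ∈ F` for some `x₀ ≠ 0`, then `η` takes all its values in `F`, and evaluation at a general
point identifies the space of these `η` with `F`. In a basis of `T_r B` extending one of this space,
a maximal minor of `χ(r)` is the product of the determinant of a square block of linear forms, of
degree `dim F`, and of a residual minor. The residual minors have no common zero on `r`, so the
focal locus has length `dim F`.
-/

noncomputable section

section BinaryForms

variable {K : Type*} [Field K]

theorem finrank_map_add_finrank_inf_ker {V W : Type*} [AddCommGroup V] [Module K V]
    [AddCommGroup W] [Module K W] (f : V →ₗ[K] W) (S : Submodule K V) [FiniteDimensional K S] :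
    finrank K (S.map f) + finrank K (S ⊓ LinearMap.ker f : Submodule K V) = finrank K S := by
  rw [← (f.domRestrict S).finrank_range_add_finrank_ker, LinearMap.range_domRestrict,
    LinearMap.ker_domRestrict, ← Submodule.finrank_map_subtype_eq, Submodule.map_comap_subtype]

theorem finrank_comap_mkQ {V : Type*} [AddCommGroup V] [Module K V]
    [FiniteDimensional K V] (p : Submodule K V) (S : Submodule K (V ⧸ p)) :
    finrank K (S.comap p.mkQ) = finrank K S + finrank K p := by
  have hp : p ≤ S.comap p.mkQ := p.ker_mkQ.ge.trans (LinearMap.ker_le_comap _)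
  rw [← finrank_map_add_finrank_inf_ker p.mkQ, p.ker_mkQ, inf_eq_right.mpr hp,
    Submodule.map_comap_eq_of_surjective p.mkQ_surjective]

theorem injective_domRestrict_of_finrank_le {V W : Type*} [AddCommGroup V] [Module K V]
    [AddCommGroup W] [Module K W] {f : V →ₗ[K] W} {S : Submodule K V} [FiniteDimensional K S]
    (h : finrank K S ≤ finrank K (S.map f)) : Function.Injective (f.domRestrict S) := by
  have hker := finrank_map_add_finrank_inf_ker f S
  have : FiniteDimensional K (S ⊓ LinearMap.ker f : Submodule K V) :=
    Submodule.finiteDimensional_of_le inf_le_left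
  have hzero : finrank K (S ⊓ LinearMap.ker f : Submodule K V) = 0 := by omega
  exact LinearMap.injective_domRestrict_iff.mpr
    (disjoint_iff.mpr (Submodule.finrank_eq_zero.mp hzero))

theorem finrank_homogeneousSubmodule {σ : Type*} [Fintype σ] (d : ℕ) :
    finrank K (homogeneousSubmodule σ K d) = (Fintype.card σ + d - 1).choose d := by
  classical
  have h : {m : σ →₀ ℕ | m.degree = d} = (Finset.univ.finsuppAntidiag d : Finset (σ →₀ ℕ)) := by
    ext m
    simp [Finset.mem_finsuppAntidiag, Finsupp.degree_eq_sum]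
  rw [homogeneousSubmodule_eq_finsupp_supported, h,
    (AddMonoidAlgebra.supportedEquivFinsupp (R := K) (S := K) _).finrank_eq,
    Module.finrank_finsupp_self]
  simp [Finset.card_finsuppAntidiag_nat_eq_choose]

theorem finrank_homogeneousSubmodule_two (d : ℕ) :
    finrank K (homogeneousSubmodule (Fin 2) K d) = d + 1 := by
  rw [finrank_homogeneousSubmodule, Fintype.card_fin, show 2 + d - 1 = d + 1 by omega,
    Nat.choose_succ_self_right]

instance (d : ℕ) : FiniteDimensional K (homogeneousSubmodule (Fin 2) K d) :=
  FiniteDimensional.of_finrank_pos (by rw [finrank_homogeneousSubmodule_two]; omega)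

theorem exists_forall_isHomogeneous_mem [IsAlgClosed K] (J : Ideal (MvPolynomial (Fin 2) K))
    (hJ : ∀ x : Fin 2 → K, x ≠ 0 → ∃ q ∈ J, eval x q ≠ 0) :
    ∃ d₀, ∀ d, d₀ ≤ d → ∀ p : MvPolynomial (Fin 2) K, p.IsHomogeneous d → p ∈ J := by
  have hX : ∀ i : Fin 2, (X i : MvPolynomial (Fin 2) K) ∈ J.radical := by
    intro i
    rw [← vanishingIdeal_zeroLocus_eq_radical (K := K), mem_vanishingIdeal_iff]
    intro x hx
    by_cases h0 : x = 0
    · simp [h0]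
    · obtain ⟨q, hq, hne⟩ := hJ x h0
      exact absurd (by simpa [aeval_eq_eval] using hx q hq) hne
  obtain ⟨a, ha⟩ := hX 0
  obtain ⟨c, hc⟩ := hX 1
  refine ⟨a + c, fun d hd p hp => ?_⟩
  rw [p.as_sum]
  refine J.sum_mem fun m hm => ?_
  have hdeg : m 0 + m 1 = d := by
    have := hp (mem_support_iff.mp hm)
    simpa [Finsupp.weight_apply, Finsupp.sum_fintype] using this
  have hmon : monomial m (coeff m p) = C (coeff m p) * (X 0 ^ m 0 * X 1 ^ m 1) := by
    rw [monomial_eq, Finsupp.prod_fintype _ _ (by simp), Fin.prod_univ_two]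
  rw [hmon]
  apply J.mul_mem_left
  rcases le_or_gt a (m 0) with h | h
  · exact J.mul_mem_right _ (J.pow_mem_of_pow_mem ha h)
  · exact J.mul_mem_left _ (J.pow_mem_of_pow_mem hc (by omega))

theorem homogeneousComponent_mul_of_isHomogeneous {σ R : Type*} [CommSemiring R]
    {P : MvPolynomial σ R} {κ : ℕ} (hP : P.IsHomogeneous κ) (h : MvPolynomial σ R) (d : ℕ) :
    homogeneousComponent (κ + d) (P * h) = P * homogeneousComponent d h := by
  have hterm : ∀ i, homogeneousComponent (κ + d) (P * homogeneousComponent i h) =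
      if d = i then P * homogeneousComponent i h else 0 := by
    intro i
    rw [homogeneousComponent_of_mem (hP.mul (homogeneousComponent_isHomogeneous i h))]
    simp only [Nat.add_left_cancel_iff]
  conv_lhs => rw [← sum_homogeneousComponent h, Finset.mul_sum, map_sum]
  rw [Finset.sum_congr rfl fun i _ => hterm i, Finset.sum_ite_eq]
  split_ifs with hi
  · rfl
  · rw [homogeneousComponent_eq_zero, mul_zero]
    simpa [Nat.lt_succ_iff] using hi

theorem hilbertFunction_add_finrank (I : Ideal (MvPolynomial (Fin 2) K)) (d : ℕ) :
    ProjLine.hilbertFunction I d +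
      finrank K (homogeneousSubmodule (Fin 2) K d ⊓ I.restrictScalars K : Submodule K _) =
        d + 1 := by
  have hker : LinearMap.ker (Ideal.Quotient.mkₐ K I).toLinearMap = I.restrictScalars K := by
    ext p
    exact Ideal.Quotient.eq_zero_iff_mem
  rw [ProjLine.hilbertFunction, ← hker, finrank_map_add_finrank_inf_ker,
    finrank_homogeneousSubmodule_two]

theorem hilbertFunction_span_mul_eventually_eq [IsAlgClosed K] {P : MvPolynomial (Fin 2) K} {κ : ℕ}
    (hP : P.IsHomogeneous κ) (hP0 : P ≠ 0) (J : Ideal (MvPolynomial (Fin 2) K))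
    (hJ : ∀ x : Fin 2 → K, x ≠ 0 → ∃ q ∈ J, eval x q ≠ 0) :
    ∀ᶠ d in atTop, ProjLine.hilbertFunction (Ideal.span {P} * J) d = κ := by
  obtain ⟨d₀, hd₀⟩ := exists_forall_isHomogeneous_mem J hJ
  filter_upwards [eventually_ge_atTop (κ + d₀)] with d hd
  obtain ⟨e, rfl⟩ : ∃ e, d = κ + e := ⟨d - κ, by omega⟩
  have hforms : (homogeneousSubmodule (Fin 2) K (κ + e) ⊓
      (Ideal.span {P} * J).restrictScalars K : Submodule K _) =
        (homogeneousSubmodule (Fin 2) K e).map (LinearMap.mulLeft K P) := by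
    ext p
    simp only [Submodule.mem_inf, Submodule.restrictScalars_mem, Submodule.mem_map,
      Ideal.mem_span_singleton_mul, mem_homogeneousSubmodule, LinearMap.mulLeft_apply]
    constructor
    · rintro ⟨hp, q, -, rfl⟩
      refine ⟨homogeneousComponent e q, homogeneousComponent_isHomogeneous e q, ?_⟩
      rw [← homogeneousComponent_mul_of_isHomogeneous hP, homogeneousComponent_of_mem hp,
        if_pos rfl]
    · rintro ⟨q, hq, rfl⟩
      exact ⟨hP.mul hq, q, hd₀ e (by omega) q hq, rfl⟩
  have h := hilbertFunction_add_finrank (Ideal.span {P} * J) (κ + e)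
  rw [hforms, ← (Submodule.equivMapOfInjective (LinearMap.mulLeft K P)
    (mul_right_injective₀ hP0) _).finrank_eq, finrank_homogeneousSubmodule_two] at h
  omega

end BinaryForms

section Pencils

variable {K : Type*} [Field K] {H W : Type*} [AddCommGroup H] [Module K H]
  [AddCommGroup W] [Module K W] {T : Submodule K (H →ₗ[K] W)} {𝒢 : Filter H}

/-- The fixed space of a linear system `T` of maps `H → W`: the vectors of `W` lying in
`{τ x | τ ∈ T}` for the general `x`, where the filter `𝒢` says what "general" means. -/
def fixedSpace (T : Submodule K (H →ₗ[K] W)) (𝒢 : Filter H) : Submodule K W where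
  carrier := {y | ∀ᶠ x in 𝒢, y ∈ T.map (LinearMap.applyₗ x)}
  zero_mem' := Eventually.of_forall fun _ => zero_mem _
  add_mem' h h' := by filter_upwards [h, h'] with x hx hx' using add_mem hx hx'
  smul_mem' c _ h := by filter_upwards [h] with x hx using Submodule.smul_mem _ c hx

theorem mem_fixedSpace {y : W} :
    y ∈ fixedSpace T 𝒢 ↔ ∀ᶠ x in 𝒢, y ∈ T.map (LinearMap.applyₗ x) := Iff.rfl

theorem eventually_fixedSpace_le [FiniteDimensional K W] :
    ∀ᶠ x in 𝒢, fixedSpace T 𝒢 ≤ T.map (LinearMap.applyₗ x) := by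
  obtain ⟨s, hs⟩ := IsNoetherian.noetherian (fixedSpace T 𝒢)
  have hmem : ∀ y ∈ s, ∀ᶠ x in 𝒢, y ∈ T.map (LinearMap.applyₗ x) := fun y hy =>
    mem_fixedSpace.mp (hs.le (Submodule.subset_span hy))
  filter_upwards [(eventually_all_finset s).mpr hmem] with x hx
  rw [← hs, Submodule.span_le]
  exact hx

theorem exists_eq_smul_add_smul (hH : finrank K H = 2) {x₀ x₁ : H} (h0 : x₀ ≠ 0)
    (h1 : x₁ ∉ Submodule.span K {x₀}) (x : H) : ∃ a b : K, x = a • x₀ + b • x₁ := by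
  have hli : LinearIndependent K ![x₀, x₁] := by
    rw [LinearIndependent.pair_iff' h0]
    intro a ha
    exact h1 (Submodule.mem_span_singleton.mpr ⟨a, ha⟩)
  have := FiniteDimensional.of_finrank_pos (K := K) (V := H) (by omega)
  have hx : x ∈ Submodule.span K (Set.range ![x₀, x₁]) :=
    hli.span_eq_top_of_card_eq_finrank' (by simp [hH]) ▸ Submodule.mem_top
  rw [Matrix.range_cons, Matrix.range_cons, Matrix.range_empty, Set.union_empty,
    Set.singleton_union, Submodule.mem_span_pair] at hx
  obtain ⟨a, b, h⟩ := hx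
  exact ⟨a, b, h.symm⟩

/-- If `τ x₀ = σ x₀ = y` with `σ ∈ T` depending on the general point, then `τ - σ` vanishes at `x₀`,
so its values are all proportional to each other. -/
theorem apply_mem_fixedSpace (h𝒢 : ∀ x₀ : H, ∀ᶠ x in 𝒢, x ∉ Submodule.span K {x₀})
    (hH : finrank K H = 2) {τ : H →ₗ[K] W} (hτ : τ ∈ T) {x₀ : H}
    (h0 : x₀ ≠ 0) (hF : τ x₀ ∈ fixedSpace T 𝒢) (x₁ : H) : τ x₁ ∈ fixedSpace T 𝒢 := by
  by_cases h1 : x₁ ∈ Submodule.span K {x₀}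
  · obtain ⟨a, rfl⟩ := Submodule.mem_span_singleton.mp h1
    rw [map_smul]
    exact Submodule.smul_mem _ a hF
  rw [mem_fixedSpace] at hF ⊢
  filter_upwards [h𝒢 x₀, hF] with x hx hFx
  obtain ⟨σ, hσ, hσx⟩ := hFx
  obtain ⟨a, b, rfl⟩ := exists_eq_smul_add_smul hH h0 h1 x
  have hb : b ≠ 0 := by
    rintro rfl
    exact hx (Submodule.mem_span_singleton.mpr ⟨a, by simp⟩)
  refine ⟨b⁻¹ • (τ - a • σ), T.smul_mem _ (T.sub_mem hτ (T.smul_mem a hσ)), ?_⟩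
  rw [LinearMap.applyₗ_apply_apply] at hσx ⊢
  rw [LinearMap.smul_apply, LinearMap.sub_apply, LinearMap.smul_apply, hσx, map_add, map_smul,
    map_smul, add_sub_cancel_left, smul_smul, inv_mul_cancel₀ hb, one_smul]

/-- The maximal minors of a linear system are taken from the matrices of this kind: the entries are
the linear forms `s ↦ φ i (t j (s₀ b₀ + s₁ b₁))` in the coordinates `s` with respect to `b`. -/
def pencilMatrix {ι κ : Type*} (b : Fin 2 → H) (φ : ι → Dual K W) (t : κ → (H →ₗ[K] W)) :
    Matrix ι κ (MvPolynomial (Fin 2) K) :=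
  Matrix.of fun i j => ∑ a : Fin 2, C (φ i (t j (b a))) * X a

variable {ι κ μ : Type*} {b : Fin 2 → H}

theorem eval_pencilMatrix (φ : ι → Dual K W) (t : κ → (H →ₗ[K] W)) (i : ι) (j : κ)
    (s : Fin 2 → K) : eval s (pencilMatrix b φ t i j) = φ i (t j (∑ a, s a • b a)) := by
  simp [pencilMatrix, mul_comm]

theorem pencilMatrix_submatrix {ι' κ' : Type*} (φ : ι → Dual K W) (t : κ → (H →ₗ[K] W))
    (p : ι' → ι) (q : κ' → κ) :
    (pencilMatrix b φ t).submatrix p q = pencilMatrix b (φ ∘ p) (t ∘ q) := rfl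

theorem pencilMatrix_mul_map_C [Fintype κ] (φ : ι → Dual K W) (t : κ → (H →ₗ[K] W))
    (M : Matrix κ μ K) :
    pencilMatrix b φ t * M.map (C (σ := Fin 2)) = pencilMatrix b φ fun j => ∑ k, M k j • t k := by
  ext1 i j
  simp only [pencilMatrix, Matrix.mul_apply, Matrix.of_apply, Matrix.map_apply,
    LinearMap.sum_apply, LinearMap.smul_apply, map_sum, map_smul, smul_eq_mul, map_mul,
    Finset.sum_mul]
  rw [Finset.sum_comm]
  exact Finset.sum_congr rfl fun a _ => Finset.sum_congr rfl fun k _ => by ring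

theorem map_C_mul_pencilMatrix [Fintype ι] (φ : ι → Dual K W) (t : κ → (H →ₗ[K] W))
    (M : Matrix μ ι K) :
    M.map (C (σ := Fin 2)) * pencilMatrix b φ t = pencilMatrix b (fun i => ∑ k, M i k • φ k) t := by
  ext1 i j
  simp only [pencilMatrix, Matrix.mul_apply, Matrix.of_apply, Matrix.map_apply,
    LinearMap.sum_apply, LinearMap.smul_apply, map_sum, smul_eq_mul, map_mul,
    Finset.sum_mul, Finset.mul_sum]
  rw [Finset.sum_comm]
  exact Finset.sum_congr rfl fun a _ => Finset.sum_congr rfl fun k _ => by ring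

theorem isHomogeneous_det {σ R : Type*} [CommRing R] [Fintype ι] [DecidableEq ι]
    {M : Matrix ι ι (MvPolynomial σ R)} (hM : ∀ i j, (M i j).IsHomogeneous 1) :
    M.det.IsHomogeneous (Fintype.card ι) := by
  rw [Matrix.det_apply]
  refine IsHomogeneous.sum _ _ _ fun p _ => ?_
  have h : (∏ i, M (p i) i).IsHomogeneous (Fintype.card ι) := by
    simpa using IsHomogeneous.prod Finset.univ (fun i => M (p i) i) (fun _ => 1)
      fun i _ => hM _ _
  rcases Int.units_eq_one_or (Equiv.Perm.sign p) with hs | hs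
  · simpa [hs] using h
  · simpa [hs] using h.neg

theorem isHomogeneous_det_pencilMatrix [Fintype ι] [DecidableEq ι] (φ : ι → Dual K W)
    (t : ι → (H →ₗ[K] W)) : (pencilMatrix b φ t).det.IsHomogeneous (Fintype.card ι) :=
  isHomogeneous_det fun i j => IsHomogeneous.sum Finset.univ (fun a => C (φ i (t j (b a))) * X a) _
    fun a _ => isHomogeneous_C_mul_X _ a

/-- The ideal of the minors of order `m` of a linear system. -/
def minorsIdeal (T : Submodule K (H →ₗ[K] W)) (b : Fin 2 → H) (m : ℕ) :
    Ideal (MvPolynomial (Fin 2) K) :=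
  Ideal.span {P | ∃ (φ : Fin m → Dual K W) (η : Fin m → (H →ₗ[K] W)),
    (∀ j, η j ∈ T) ∧ P = (pencilMatrix b φ η).det}

theorem minorsIdeal_eq_span_range_det [Fintype ι] [DecidableEq ι] (t : Basis ι K T) :
    minorsIdeal T b (finrank K T) =
      Ideal.span (Set.range fun φ : ι → Dual K W => (pencilMatrix b φ fun i => t i).det) := by
  let e : Fin (finrank K T) ≃ ι :=
    Fintype.equivOfCardEq (by rw [Fintype.card_fin, finrank_eq_card_basis t])
  apply le_antisymm <;> rw [minorsIdeal, Ideal.span_le]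
  · rintro _ ⟨φ, η, hη, rfl⟩
    let M : Matrix ι ι K := Matrix.of fun i j => t.repr ⟨η (e.symm j), hη _⟩ i
    have hM : (pencilMatrix b (φ ∘ e.symm) fun i => t i) * M.map (C (σ := Fin 2)) =
        (pencilMatrix b φ η).submatrix e.symm e.symm := by
      rw [pencilMatrix_mul_map_C, pencilMatrix_submatrix]
      congr 1
      funext i
      have := congrArg Subtype.val (t.sum_repr ⟨η (e.symm i), hη _⟩)
      rwa [Submodule.coe_sum] at this
    rw [← Matrix.det_submatrix_equiv_self e.symm, ← hM, Matrix.det_mul]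
    exact Ideal.mul_mem_right _ _ (Ideal.subset_span ⟨_, rfl⟩)
  · rintro _ ⟨φ, rfl⟩
    exact Ideal.subset_span ⟨φ ∘ e, fun j => t (e j), fun j => (t (e j)).2,
      (Matrix.det_submatrix_equiv_self e _).symm⟩

theorem exists_dual_apply_eq_ite [DecidableEq ι] {v : ι → W} (hv : LinearIndependent K v) :
    ∃ φ : ι → Dual K W, ∀ i j, φ i (v j) = if i = j then 1 else 0 := by
  choose φ hφ using fun i => LinearMap.exists_extend (Finsupp.lapply i ∘ₗ hv.repr)
  refine ⟨φ, fun i j => ?_⟩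
  have h := LinearMap.congr_fun (hφ i)
    (⟨v j, Submodule.subset_span ⟨j, rfl⟩⟩ : Submodule.span K (Set.range v))
  rw [LinearMap.comp_apply, Submodule.subtype_apply, LinearMap.comp_apply,
    hv.repr_eq_single j _ rfl, Finsupp.lapply_apply, Finsupp.single_apply] at h
  simpa only [eq_comm] using h

/-- Modulo the space with basis `f`, what remains of the matrix `pencilMatrix b φ` of a linear
system once its maps with values in that space are replaced by the basis. -/
def residualMatrix {ν : Type*} (b : Fin 2 → H) (φ : ν → Dual K W) (f : ι → W)
    (t : κ → (H →ₗ[K] W)) : Matrix ν (ι ⊕ κ) (MvPolynomial (Fin 2) K) :=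
  Matrix.fromCols (Matrix.of fun i l => C (φ i (f l))) (pencilMatrix b φ t)

theorem pencilMatrix_eq_residualMatrix_mul {ν : Type*} [Fintype ι] [DecidableEq κ] [Fintype κ]
    {F : Submodule K W} (f : Basis ι K F) (g : μ → (H →ₗ[K] F)) (t : κ → (H →ₗ[K] W))
    (φ : ν → Dual K W) :
    pencilMatrix b φ (Sum.elim (fun j => F.subtype ∘ₗ g j) t) =
      residualMatrix b φ (fun l => f l) t *
        (Matrix.fromBlocks (pencilMatrix b f.coord g) 0 0 1 : Matrix (ι ⊕ κ) (μ ⊕ κ) _) := by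
  have hφ : ∀ i, ∑ l, φ i (f l) • f.coord l = φ i ∘ₗ F.subtype := fun i =>
    f.ext fun l => by classical simp [Finsupp.single_apply]
  have hfixed : (Matrix.of fun i l => C (σ := Fin 2) (φ i (f l))) * pencilMatrix b f.coord g =
      pencilMatrix b φ fun j => F.subtype ∘ₗ g j := by
    have h := map_C_mul_pencilMatrix (b := b) f.coord g (Matrix.of fun i l => φ i (f l))
    simp only [Matrix.of_apply, hφ] at h
    exact h
  rw [residualMatrix, Matrix.fromCols_mul_fromBlocks, hfixed, Matrix.mul_zero, Matrix.mul_zero,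
    Matrix.mul_one, add_zero, zero_add]
  ext1 i (j | j) <;> rfl

theorem det_pencilMatrix_eq_mul [Fintype ι] [DecidableEq ι] [Fintype κ] [DecidableEq κ]
    {F : Submodule K W} (f : Basis ι K F) (g : ι → (H →ₗ[K] F)) (t : κ → (H →ₗ[K] W))
    (φ : ι ⊕ κ → Dual K W) :
    (pencilMatrix b φ (Sum.elim (fun j => F.subtype ∘ₗ g j) t)).det =
      (pencilMatrix b f.coord g).det * (residualMatrix b φ (fun l => f l) t).det := by
  rw [pencilMatrix_eq_residualMatrix_mul f, Matrix.det_mul, Matrix.det_fromBlocks_zero₂₁,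
    Matrix.det_one, mul_one, mul_comm]

theorem exists_eval_det_residualMatrix_ne_zero [Fintype ι] [DecidableEq ι] [Fintype κ]
    [DecidableEq κ] {f : ι → W} {t : κ → (H →ₗ[K] W)} {s : Fin 2 → K}
    (hli : LinearIndependent K (Sum.elim f fun j => t j (∑ a, s a • b a))) :
    ∃ φ : ι ⊕ κ → Dual K W, eval s (residualMatrix b φ f t).det ≠ 0 := by
  obtain ⟨φ, hφ⟩ := exists_dual_apply_eq_ite hli
  refine ⟨φ, ?_⟩
  have hone : (residualMatrix b φ f t).map (eval s) = 1 := by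
    ext1 i j
    rw [Matrix.one_apply, ← hφ i j]
    rcases j with j | j
    · exact eval_C _
    · exact eval_pencilMatrix _ _ _ _ _
  rw [RingHom.map_det, RingHom.mapMatrix_apply, hone, Matrix.det_one]
  exact one_ne_zero

theorem comap_eval_fixedSpace_eq
    (h𝒢 : ∀ x₀ : H, ∀ᶠ x in 𝒢, x ∉ Submodule.span K {x₀}) (hH : finrank K H = 2) {x y : H}
    (hx : x ≠ 0) (hy : y ≠ 0) :
    (fixedSpace T 𝒢).comap ((LinearMap.applyₗ x).domRestrict T) =
      (fixedSpace T 𝒢).comap ((LinearMap.applyₗ y).domRestrict T) :=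
  le_antisymm (fun τ hτ => apply_mem_fixedSpace h𝒢 hH τ.2 hx hτ y)
    fun τ hτ => apply_mem_fixedSpace h𝒢 hH τ.2 hy hτ x

/-- The basis `t'` starts with a basis of the subspace of the maps with values in `F`, so that the
other maps `t` stay independent modulo `F` when they are evaluated at any `y ≠ 0`. -/
theorem exists_basis_sumElim_subtype_comp [FiniteDimensional K W] [FiniteDimensional K H]
    {F : Submodule K W} (f : Basis ι K F) {x₁ : H} (hx₁ : F ≤ T.map (LinearMap.applyₗ x₁))
    (hinj : Function.Injective ((LinearMap.applyₗ x₁).domRestrict T))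
    (hF : ∀ y ≠ 0, F.comap ((LinearMap.applyₗ x₁).domRestrict T) =
      F.comap ((LinearMap.applyₗ y).domRestrict T)) :
    ∃ (q : ℕ) (g : ι → (H →ₗ[K] F)) (t : Fin q → (H →ₗ[K] W)) (t' : Basis (ι ⊕ Fin q) K T),
      (∀ l, g l x₁ = f l) ∧
        (∀ i, (t' i : H →ₗ[K] W) = Sum.elim (fun l => F.subtype ∘ₗ g l) t i) ∧
          ∀ y ≠ 0, LinearIndependent K (Sum.elim (fun l => (f l : W)) fun j => t j y) := by
  set S : Submodule K T := F.comap ((LinearMap.applyₗ x₁).domRestrict T)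
  have hmem : ∀ (τ : S) (y : H), τ.1.1 y ∈ F := by
    intro τ y
    by_cases hy : y = 0
    · rw [hy, map_zero]
      exact zero_mem _
    · exact (hF y hy).le τ.2
  let e : S ≃ₗ[K] F := LinearEquiv.ofBijective
    (((LinearMap.applyₗ x₁).domRestrict T).restrict fun _ h => h)
    ⟨fun τ σ h => Subtype.ext (hinj (congrArg Subtype.val h)), fun y => by
      obtain ⟨τ, hτ, hy⟩ := hx₁ y.2
      exact ⟨⟨⟨τ, hτ⟩, (congrArg (· ∈ F) hy).mpr y.2⟩, Subtype.ext hy⟩⟩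
  let t₂ := finBasis K (T ⧸ S)
  let t' : Basis (ι ⊕ Fin _) K T := Basis.sumQuot (f.map e.symm) t₂
  refine ⟨_, fun l => (e.symm (f l)).1.1.codRestrict F (hmem _), fun j => t' (Sum.inr j), t',
    fun l => e.apply_symm_apply (f l), ?_, fun y hy => ?_⟩
  · rintro (l | j)
    · exact congrArg Subtype.val (Basis.sumQuot_inl _ _ l)
    · rfl
  · refine f.linearIndependent.sumElim_of_quotient _ ?_
    let m : T ⧸ S →ₗ[K] W ⧸ F := S.mapQ F ((LinearMap.applyₗ y).domRestrict T) (hF y hy).le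
    have hker : LinearMap.ker m = ⊥ := by
      rw [Submodule.ker_mapQ, ← hF y hy, Submodule.mkQ_map_self]
    have ht₂ : Submodule.Quotient.mk (p := F) ∘ (fun j => (t' (Sum.inr j)).1 y) = m ∘ t₂ := by
      funext j
      rw [Function.comp_apply, Function.comp_apply, ← Basis.sumQuot_inr (f.map e.symm) t₂ j]
      rfl
    rw [ht₂]
    exact t₂.linearIndependent.map' m hker

/-- `P` is the determinant of the square block of the maps with values in the fixed space, and `J`
is generated by the determinants of the residual matrices. -/
theorem exists_minorsIdeal_eq_span_singleton_mul [FiniteDimensional K W] [NeBot 𝒢]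
    (h𝒢 : ∀ x₀ : H, ∀ᶠ x in 𝒢, x ∉ Submodule.span K {x₀})
    (hT : ∀ᶠ x in 𝒢, Function.Injective ((LinearMap.applyₗ x).domRestrict T))
    (hH : finrank K H = 2) (b : Basis (Fin 2) K H) :
    ∃ (P : MvPolynomial (Fin 2) K) (J : Ideal (MvPolynomial (Fin 2) K)),
      P.IsHomogeneous (finrank K (fixedSpace T 𝒢)) ∧ P ≠ 0 ∧
        (∀ s : Fin 2 → K, s ≠ 0 → ∃ q ∈ J, eval s q ≠ 0) ∧
          minorsIdeal T b (finrank K T) = Ideal.span {P} * J := by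
  let f := finBasis K (fixedSpace T 𝒢)
  have := FiniteDimensional.of_finrank_pos (K := K) (V := H) (by omega)
  obtain ⟨x₁, hx₁, hspan, hinj⟩ :=
    ((eventually_fixedSpace_le (T := T)).and ((h𝒢 0).and hT)).exists
  have hx0 : x₁ ≠ 0 := fun h => hspan (by rw [h]; exact zero_mem _)
  obtain ⟨q, g, t, t', hg, ht', hli⟩ := exists_basis_sumElim_subtype_comp f hx₁ hinj
    fun y hy => comap_eval_fixedSpace_eq h𝒢 hH hx0 hy
  refine ⟨(pencilMatrix b f.coord g).det,
    Ideal.span (Set.range fun φ => (residualMatrix b φ (fun l => (f l : W)) t).det), ?_, ?_, ?_, ?_⟩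
  · simpa only [Fintype.card_fin] using isHomogeneous_det_pencilMatrix (b := b) f.coord g
  · intro h0
    have hone : (pencilMatrix b f.coord g).map (eval (b.repr x₁)) = 1 := by
      ext1 i j
      rw [Matrix.map_apply, eval_pencilMatrix, b.sum_repr, hg, f.coord_apply, f.repr_self_apply,
        Matrix.one_apply]
      simp only [eq_comm]
    have := congrArg (eval (b.repr x₁)) h0
    rw [RingHom.map_det, RingHom.mapMatrix_apply, hone, Matrix.det_one, map_zero] at this
    exact one_ne_zero this
  · intro s hs
    have hy : ∑ a, s a • b a ≠ 0 := fun h =>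
      hs (funext (Fintype.linearIndependent_iff.mp b.linearIndependent s h))
    obtain ⟨φ, hφ⟩ := exists_eval_det_residualMatrix_ne_zero (hli _ hy)
    exact ⟨_, Ideal.subset_span ⟨φ, rfl⟩, hφ⟩
  · rw [minorsIdeal_eq_span_range_det t', Ideal.span_mul_span', Set.singleton_mul,
      ← Set.range_comp]
    simp only [ht', det_pencilMatrix_eq_mul f g t, Function.comp_def]

end Pencils

namespace ProjLine

theorem hasFocalLength_iff_finrank_fixedSpace {K : Type*} [Field K] [IsAlgClosed K] {N : ℕ}
    {B : Set (ProjLine K N)} {r : ProjLine K N} {𝒢 : Filter r.hat} [NeBot 𝒢]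
    (h𝒢 : ∀ x₀ : r.hat, ∀ᶠ x in 𝒢, x ∉ Submodule.span K {x₀})
    (hT : ∀ᶠ x in 𝒢, Function.Injective ((LinearMap.applyₗ x).domRestrict (tangentSpace B r)))
    (k : ℕ) : HasFocalLength B r k ↔ finrank K (fixedSpace (tangentSpace B r) 𝒢) = k := by
  have hlength : ∀ b : Basis (Fin 2) K r.hat, ∀ᶠ d in atTop,
      hilbertFunction (focalIdeal B r b) d = finrank K (fixedSpace (tangentSpace B r) 𝒢) := by
    intro b
    obtain ⟨x, hx⟩ := hT.exists
    obtain ⟨P, J, hP, hP0, hJ, hminors⟩ :=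
      exists_minorsIdeal_eq_span_singleton_mul h𝒢 hT r.finrank_hat b
    have hfocal :
        focalIdeal B r b = minorsIdeal (tangentSpace B r) b (finrank K (tangentSpace B r)) := by
      rw [focalIdeal, min_eq_left (LinearMap.finrank_le_finrank_of_injective hx)]
      rfl
    rw [hfocal, hminors]
    exact hilbertFunction_span_mul_eventually_eq hP hP0 J hJ
  constructor
  · intro hk
    obtain ⟨d, hd, hd'⟩ := ((hlength (finBasisOfFinrankEq K _ r.finrank_hat)).and (hk _)).exists
    exact hd.symm.trans hd'
  · rintro rfl
    exact hlength

end ProjLine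

section Derivations

variable {K E : Type*} [Field K] [Field E] [Algebra K E]

/-- The solution space, over the field `E`, of the linear system whose equations have the values at
`y` of the polynomial vectors in `S` as coefficients. -/
def solutionSpace {σ τ : Type*} [Fintype τ] (S : Set (τ → MvPolynomial σ K)) (y : σ → E) :
    Submodule E (τ → E) where
  carrier := {v | ∀ f ∈ S, ∑ i, aeval y (f i) * v i = 0}
  zero_mem' := by simp
  add_mem' hv hw f hf := by
    simp only [Pi.add_apply, mul_add, Finset.sum_add_distrib, hv f hf, hw f hf, add_zero]
  smul_mem' c v hv f hf := by
    simp only [Pi.smul_apply, smul_eq_mul, mul_left_comm _ c, ← Finset.mul_sum, hv f hf, mul_zero]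

/-- The gradients of the polynomials in `I`: the equations of the tangent spaces to the zero locus
of `I`. -/
def gradients {σ : Type*} (I : Ideal (MvPolynomial σ K)) : Set (σ → MvPolynomial σ K) :=
  {f | ∃ F ∈ I, f = fun i => pderiv i F}

theorem mem_solutionSpace_gradients {σ : Type*} [Fintype σ] {I : Ideal (MvPolynomial σ K)}
    {y v : σ → E} :
    v ∈ solutionSpace (gradients I) y ↔ ∀ F ∈ I, ∑ i, aeval y (pderiv i F) * v i = 0 :=
  ⟨fun h F hF => h _ ⟨F, hF, rfl⟩, by rintro h _ ⟨F, hF, rfl⟩; exact h F hF⟩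

theorem derivation_aeval {A : Type*} [CommRing A] [Algebra K A] {σ : Type*} [Fintype σ]
    (D : Derivation K A A) (y : σ → A) (P : MvPolynomial σ K) :
    D (aeval y P) = ∑ i, aeval y (pderiv i P) * D (y i) := by
  classical
  induction P using MvPolynomial.induction_on with
  | C c => simp
  | add p q hp hq => simp only [map_add, hp, hq, add_mul, Finset.sum_add_distrib]
  | mul_X p i hp =>
    simp [Derivation.leibniz, hp, pderiv_X, Pi.single_apply, add_mul, Finset.sum_add_distrib,
      Finset.mul_sum, mul_assoc, apply_ite (aeval y)]

/-- Tensoring with `E`, formal smoothness makes `E ⊗ Ω[A⁄K] → Ω[E⁄K]` a split injection. -/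
theorem exists_derivation_extending {A : Type*} [CommRing A] [Algebra K A] [Algebra A E]
    [IsScalarTower K A E] [Algebra.FormallySmooth A E] (d : Derivation K A E) :
    ∃ D : Derivation K E E, ∀ a, D (algebraMap A E a) = d a := by
  have hinj : Function.Injective (KaehlerDifferential.mapBaseChange K A E) := by
    rw [injective_iff_map_eq_zero]
    intro x hx
    obtain ⟨c, rfl⟩ := (Algebra.H1Cotangent.exact_δ_mapBaseChange K A E x).mp hx
    rw [Subsingleton.elim c 0, map_zero]
  obtain ⟨g, hg⟩ := LinearMap.exists_leftInverse_of_injective _ (LinearMap.ker_eq_bot.mpr hinj)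
  let φ : TensorProduct A E (Ω[A⁄K]) →ₗ[E] E := TensorProduct.AlgebraTensorModule.lift
    ((LinearMap.lsmul E (Ω[A⁄K] →ₗ[A] E)).flip d.liftKaehlerDifferential)
  refine ⟨(φ ∘ₗ g).compDer (KaehlerDifferential.D K E), fun a => ?_⟩
  have hD : KaehlerDifferential.D K E (algebraMap A E a) =
      KaehlerDifferential.mapBaseChange K A E (1 ⊗ₜ KaehlerDifferential.D K A a) := by
    simp
  calc φ (g (KaehlerDifferential.D K E (algebraMap A E a)))
      = φ (1 ⊗ₜ KaehlerDifferential.D K A a) := by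
        rw [hD]
        exact congrArg φ (LinearMap.congr_fun hg _)
    _ = d a := by simp [φ]

theorem exists_derivation_of_mem_solutionSpace {σ : Type*} [Fintype σ] [CharZero K]
    [Algebra.EssFiniteType K E] {y v : σ → E}
    (hv : v ∈ solutionSpace (gradients (RingHom.ker (aeval (R := K) y))) y) :
    ∃ D : Derivation K E E, ∀ i, D (y i) = v i := by
  let A := Algebra.adjoin K (Set.range y)
  let F := IntermediateField.adjoin K (Set.range y)
  open scoped IntermediateField.algebraAdjoinAdjoin in
  have : Algebra.FormallySmooth A E := by
    have : Algebra.FormallySmooth A F := .of_isLocalization (nonZeroDivisors A)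
    have : Algebra.EssFiniteType F E := .of_comp K F E
    exact .comp A F E
  choose P hP using fun a : A => show ∃ P : MvPolynomial σ K, aeval y P = a by
    simpa [A, Algebra.adjoin_range_eq_range_aeval] using a.2
  have hd : ∀ (a : A) (Q : MvPolynomial σ K), aeval y Q = a →
      ∑ i, aeval y (pderiv i (P a)) * v i = ∑ i, aeval y (pderiv i Q) * v i := by
    intro a Q hQ
    have h := mem_solutionSpace_gradients.mp hv (P a - Q) (by simp [RingHom.mem_ker, hP, hQ])
    simpa only [map_sub, sub_mul, Finset.sum_sub_distrib, sub_eq_zero] using h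
  let d : Derivation K A E := Derivation.mk'
    { toFun a := ∑ i, aeval y (pderiv i (P a)) * v i
      map_add' a b := by
        rw [hd (a + b) (P a + P b) (by simp [hP])]
        simp only [map_add, add_mul, Finset.sum_add_distrib]
      map_smul' c a := by
        rw [hd (c • a) (c • P a) (by simp [hP])]
        simp [Derivation.map_smul, Finset.smul_sum] }
    fun a b => by
      change ∑ i, _ = _
      rw [hd (a * b) (P a * P b) (by simp [hP])]
      simp [Derivation.leibniz, hP, add_mul, Finset.sum_add_distrib, Finset.mul_sum, mul_assoc,
        Algebra.smul_def]
  obtain ⟨D, hD⟩ := exists_derivation_extending d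
  refine ⟨D, fun i => ?_⟩
  classical
  have h := hD ⟨y i, Algebra.subset_adjoin ⟨i, rfl⟩⟩
  refine h.trans ((hd _ (X i) (by simp)).trans ?_)
  simp [pderiv_X, Pi.single_apply, apply_ite (aeval y)]

theorem derivation_apply_eq_zero_of_isAlgebraic [CharZero K] {D : Derivation K E E}
    {A : Subalgebra K E} (hA : ∀ a ∈ A, D a = 0) {x : E} (hx : IsAlgebraic A x) : D x = 0 := by
  let D' : Derivation A E E := Derivation.mk'
    { D.toLinearMap with
      map_smul' := fun a e => by simp [Algebra.smul_def, hA _ a.2] }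
    fun a b => D.leibniz a b
  have : CharZero A := charZero_of_injective_algebraMap (algebraMap K A).injective
  by_contra hDx
  have hroot : ∀ n, ∀ p : Polynomial A, p.natDegree = n → Polynomial.aeval x p = 0 → p = 0 := by
    intro n
    induction n with
    | zero =>
      intro p hp h0
      rw [Polynomial.eq_C_of_natDegree_eq_zero hp] at h0 ⊢
      simpa using h0
    | succ n ih =>
      intro p hp h0
      have hp' := D'.map_aeval p x
      rw [h0, map_zero, eq_comm, smul_eq_mul] at hp'
      have hderiv : Polynomial.derivative p = 0 :=
        ih _ (by rw [Polynomial.natDegree_derivative, hp, Nat.add_sub_cancel])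
          ((mul_eq_zero.mp hp').resolve_right hDx)
      have hconst := Polynomial.derivative_eq_zero.mp hderiv
      omega
  obtain ⟨p, hp0, hp⟩ := hx
  exact hp0 (hroot _ p rfl hp)

/-- Evaluating derivations of `E` at the coordinates of the point `y`. -/
def derivationEval {σ : Type*} [Fintype σ] (y : σ → E) :
    Derivation K E E →ₗ[E] solutionSpace (gradients (RingHom.ker (aeval (R := K) y))) y where
  toFun D := ⟨fun i => D (y i), mem_solutionSpace_gradients.mpr fun F hF => by
    rw [← derivation_aeval, RingHom.mem_ker.mp hF, map_zero]⟩
  map_add' _ _ := rfl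
  map_smul' _ _ := rfl

theorem derivationEval_bijective {σ : Type*} [Fintype σ] [CharZero K] [Algebra.EssFiniteType K E]
    (y : σ → E) [Algebra.IsAlgebraic (Algebra.adjoin K (Set.range y)) E] :
    Function.Bijective (derivationEval (K := K) y) := by
  refine ⟨(injective_iff_map_eq_zero _).mpr fun D hD => ?_, fun v => ?_⟩
  · have hy : ∀ i, D (y i) = 0 := fun i => congrFun (congrArg Subtype.val hD) i
    have hA : ∀ a ∈ Algebra.adjoin K (Set.range y), D a = 0 := by
      intro a ha
      rw [Algebra.adjoin_range_eq_range_aeval] at ha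
      obtain ⟨P, rfl⟩ := ha
      exact (derivation_aeval D y P).trans (by simp [hy])
    ext x
    exact derivation_apply_eq_zero_of_isAlgebraic hA (Algebra.IsAlgebraic.isAlgebraic x)
  · obtain ⟨D, hD⟩ := exists_derivation_of_mem_solutionSpace v.2
    exact ⟨D, Subtype.ext (funext hD)⟩

theorem finrank_solutionSpace_gradients_eq {σ : Type*} [Fintype σ] [CharZero K]
    [Algebra.EssFiniteType K E] (y : σ → E)
    [Algebra.IsAlgebraic (Algebra.adjoin K (Set.range y)) E] {d : ℕ}
    (hd : Algebra.trdeg K E = d) :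
    finrank E (solutionSpace (gradients (RingHom.ker (aeval (R := K) y))) y) = d := by
  obtain ⟨s, hs⟩ := exists_isTranscendenceBasis K E
  have hsd : Cardinal.mk s = d := hs.cardinalMk_eq_trdeg.trans hd
  obtain ⟨_⟩ := Cardinal.lt_aleph0_iff_fintype.mp (hsd ▸ Cardinal.natCast_lt_aleph0 (n := d))
  have : Algebra.IsAlgebraic (Algebra.adjoin K (Set.range ((↑) : s → E))) E := hs.isAlgebraic
  have hker : RingHom.ker (aeval (R := K) ((↑) : s → E)) = ⊥ :=
    (RingHom.injective_iff_ker_eq_bot _).mp hs.1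
  have htop : solutionSpace (gradients (RingHom.ker (aeval (R := K) ((↑) : s → E))))
      ((↑) : s → E) = ⊤ := by
    refine eq_top_iff.mpr fun v _ => mem_solutionSpace_gradients.mpr fun F hF => ?_
    rw [hker, Ideal.mem_bot] at hF
    simp [hF]
  calc _ = finrank E (Derivation K E E) :=
        (LinearEquiv.ofBijective _ (derivationEval_bijective y)).finrank_eq.symm
    _ = _ := (LinearEquiv.ofBijective _ (derivationEval_bijective ((↑) : s → E))).finrank_eq
    _ = d := by
        rw [htop, finrank_top, finrank_fintype_fun_eq_card]
        exact_mod_cast (Cardinal.mk_fintype s).symm.trans hsd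

end Derivations

section GeneralPoints

variable {K : Type*} [Field K] {σ : Type*}

theorem eval_bind₁ {τ : Type*} (p : σ → K) (φ : τ → MvPolynomial σ K) (F : MvPolynomial τ K) :
    eval p (bind₁ φ F) = eval (fun j => eval p (φ j)) F :=
  eval₂Hom_bind₁ (RingHom.id K) p φ F

theorem bind₁_mem_vanishingIdeal {τ : Type*} {Y : Set (σ → K)} {Z : Set (τ → K)}
    {φ : τ → MvPolynomial σ K} (hφ : ∀ p ∈ Y, (fun j => eval p (φ j)) ∈ Z) {F : MvPolynomial τ K}
    (hF : F ∈ vanishingIdeal K Z) : bind₁ φ F ∈ vanishingIdeal K Y :=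
  mem_vanishingIdeal_iff.mpr fun p hp =>
    (eval_bind₁ p φ F).trans (mem_vanishingIdeal_iff.mp hF _ (hφ p hp))

/-- The filter of nonempty Zariski open subsets of the irreducible set `Y`: a property holds
eventually along `generalPoints Y` if it holds for the general point of `Y`. -/
def generalPoints (Y : Set (σ → K)) : Filter (σ → K) :=
  ⨅ Q ∈ {Q | Q ∉ vanishingIdeal K Y}, 𝓟 {p ∈ Y | eval p Q ≠ 0}

variable {Y : Set (σ → K)} [hY : (vanishingIdeal K Y).IsPrime]

theorem eventually_generalPoints {P : (σ → K) → Prop} :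
    (∀ᶠ p in generalPoints Y, P p) ↔
      ∃ Q ∉ vanishingIdeal K Y, ∀ p ∈ Y, eval p Q ≠ 0 → P p := by
  have hdir : DirectedOn ((fun Q => 𝓟 {p ∈ Y | eval p Q ≠ 0}) ⁻¹'o (· ≥ ·))
      {Q | Q ∉ vanishingIdeal K Y} := fun Q hQ Q' hQ' =>
    ⟨Q * Q', hY.mul_notMem hQ hQ',
      principal_mono.mpr fun p hp => ⟨hp.1, left_ne_zero_of_mul (map_mul (eval p) Q Q' ▸ hp.2)⟩,
      principal_mono.mpr fun p hp => ⟨hp.1, right_ne_zero_of_mul (map_mul (eval p) Q Q' ▸ hp.2)⟩⟩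
  rw [Filter.Eventually, generalPoints, mem_biInf_of_directed hdir ⟨1, hY.one_notMem⟩]
  exact exists_congr fun Q => and_congr_right fun _ => mem_principal.trans
    ⟨fun h p hp hp0 => h ⟨hp, hp0⟩, fun h p hp => h p hp.1 hp.2⟩

theorem eventually_generalPoints_eval_ne_zero {Q : MvPolynomial σ K}
    (hQ : Q ∉ vanishingIdeal K Y) : ∀ᶠ p in generalPoints Y, eval p Q ≠ 0 :=
  eventually_generalPoints.mpr ⟨Q, hQ, fun _ _ h => h⟩

theorem eventually_generalPoints_mem : ∀ᶠ p in generalPoints Y, p ∈ Y :=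
  eventually_generalPoints.mpr ⟨1, hY.one_notMem, fun _ h _ => h⟩

instance generalPoints_neBot : (generalPoints Y).NeBot := by
  refine neBot_iff.mpr fun hbot => ?_
  have hfalse : ∀ᶠ _ in generalPoints Y, False := hbot ▸ eventually_bot
  obtain ⟨Q, hQ, h⟩ := eventually_generalPoints.mp hfalse
  exact hQ (mem_vanishingIdeal_iff.mpr fun p hp => by_contra fun h0 => h p hp h0)

theorem mem_vanishingIdeal_of_eventually {Q : MvPolynomial σ K}
    (h : ∀ᶠ p in generalPoints Y, eval p Q = 0) : Q ∈ vanishingIdeal K Y := by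
  by_contra hQ
  obtain ⟨p, hp, hp0⟩ := ((eventually_generalPoints_eval_ne_zero hQ).and h).exists
  exact hp hp0

theorem tendsto_generalPoints {τ : Type*} {Z : Set (τ → K)} [(vanishingIdeal K Z).IsPrime]
    {φ : τ → MvPolynomial σ K} (hφ : ∀ p ∈ Y, (fun j => eval p (φ j)) ∈ Z)
    (hdom : ∀ F, bind₁ φ F ∈ vanishingIdeal K Y → F ∈ vanishingIdeal K Z) :
    Tendsto (fun p j => eval p (φ j)) (generalPoints Y) (generalPoints Z) := by
  intro s hs
  obtain ⟨Q, hQ, h⟩ := eventually_generalPoints.mp hs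
  refine eventually_generalPoints.mpr ⟨bind₁ φ Q, mt (hdom Q) hQ, fun p hp hp0 => h _ (hφ p hp) ?_⟩
  rwa [eval_bind₁] at hp0

end GeneralPoints

section GenericPoint

variable {K : Type*} [Field K] {σ : Type*} (Y : Set (σ → K))

/-- The field of rational functions on the irreducible set `Y`. -/
abbrev RationalFunctionField : Type _ := FractionRing (MvPolynomial σ K ⧸ vanishingIdeal K Y)

/-- The coordinate functions on `Y`, as a point with coordinates in the function field. -/
def genericCoordinates : σ → RationalFunctionField Y :=
  fun i => algebraMap _ _ (Ideal.Quotient.mk (vanishingIdeal K Y) (X i))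

theorem aeval_genericCoordinates (P : MvPolynomial σ K) :
    aeval (genericCoordinates Y) P = algebraMap _ _ (Ideal.Quotient.mk (vanishingIdeal K Y) P) := by
  have h : aeval (R := K) (genericCoordinates Y) = (IsScalarTower.toAlgHom K
      (MvPolynomial σ K ⧸ vanishingIdeal K Y) (RationalFunctionField Y)).comp
        (Ideal.Quotient.mkₐ K _) := by
    ext i
    simp [genericCoordinates]
  exact congrArg (fun f => f P) h

variable {Y}

theorem aeval_genericCoordinates_eq_zero_iff {P : MvPolynomial σ K} :
    aeval (genericCoordinates Y) P = 0 ↔ P ∈ vanishingIdeal K Y := by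
  rw [aeval_genericCoordinates, map_eq_zero_iff _ (IsFractionRing.injective _ _),
    Ideal.Quotient.eq_zero_iff_mem]

theorem ker_aeval_genericCoordinates :
    RingHom.ker (aeval (R := K) (genericCoordinates Y)) = vanishingIdeal K Y :=
  Ideal.ext fun _ => aeval_genericCoordinates_eq_zero_iff

theorem exists_aeval_genericCoordinates_eq_mul [hY : (vanishingIdeal K Y).IsPrime]
    {ι : Type*} [Finite ι] (e : ι → RationalFunctionField Y) :
    ∃ Q ∉ vanishingIdeal K Y, ∃ P : ι → MvPolynomial σ K,
      ∀ i, aeval (genericCoordinates Y) (P i) = aeval (genericCoordinates Y) Q * e i := by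
  obtain ⟨b, hb⟩ := IsLocalization.exist_integer_multiples_of_finite
    (nonZeroDivisors (MvPolynomial σ K ⧸ vanishingIdeal K Y)) e
  choose a ha using hb
  obtain ⟨Q, hQ⟩ := Ideal.Quotient.mk_surjective b.1
  choose P hP using fun i => Ideal.Quotient.mk_surjective (a i)
  refine ⟨Q, fun h => nonZeroDivisors.ne_zero b.2 (hQ ▸ Ideal.Quotient.eq_zero_iff_mem.mpr h), P,
    fun i => ?_⟩
  rw [aeval_genericCoordinates, aeval_genericCoordinates, hP, hQ, ha, Algebra.smul_def]

end GenericPoint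

section GenericRank

variable {K : Type*} [Field K] {σ τ : Type*} [Fintype τ]

theorem finrank_solutionSpace_range_add_card {E : Type*} [Field E] [Algebra K E] {ι : Type*}
    [Fintype ι] {f : ι → τ → MvPolynomial σ K} {y : σ → E}
    (hf : LinearIndependent E fun k i => aeval y (f k i)) :
    finrank E (solutionSpace (Set.range f) y) + Fintype.card ι = Fintype.card τ := by
  have hker : solutionSpace (Set.range f) y =
      LinearMap.ker (Matrix.of fun k i => aeval y (f k i)).mulVecLin := by
    ext v
    rw [LinearMap.mem_ker, Matrix.mulVecLin_apply, funext_iff]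
    exact Set.forall_mem_range
  have hrank : (Matrix.of fun k i => aeval y (f k i)).rank = Fintype.card ι :=
    LinearIndependent.rank_matrix hf
  rw [hker, ← hrank, Matrix.rank, add_comm, LinearMap.finrank_range_add_finrank_ker,
    finrank_fintype_fun_eq_card]

theorem exists_linearIndependent_solutionSpace_eq {E : Type*} [Field E] [Algebra K E]
    (S : Set (τ → MvPolynomial σ K)) (y : σ → E) :
    ∃ (m : ℕ) (f : Fin m → τ → MvPolynomial σ K), Set.range f ⊆ S ∧
      LinearIndependent E (fun k i => aeval y (f k i)) ∧
        solutionSpace (Set.range f) y = solutionSpace S y := by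
  obtain ⟨g, hgS, hspan, hli⟩ := Submodule.exists_fun_fin_finrank_span_eq E
    ((fun (f : τ → MvPolynomial σ K) i => aeval y (f i)) '' S)
  choose f hfS hfg using hgS
  have hg : (fun k i => aeval y (f k i)) = g := funext hfg
  refine ⟨_, f, Set.range_subset_iff.mpr hfS, hg ▸ hli, le_antisymm (fun v hv f₀ hf₀ => ?_)
    fun v hv f₀ hf₀ => hv f₀ (Set.range_subset_iff.mpr hfS hf₀)⟩
  have hle : Submodule.span E (Set.range g) ≤ LinearMap.ker (Fintype.linearCombination E v) := by
    rw [Submodule.span_le, ← hg]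
    rintro _ ⟨k, rfl⟩
    exact hv _ ⟨k, rfl⟩
  exact hle (hspan.ge (Submodule.subset_span ⟨f₀, hf₀, rfl⟩))

variable {Y : Set (σ → K)} [hY : (vanishingIdeal K Y).IsPrime]

/-- A dual family of functionals over the function field specializes, up to a common denominator. -/
theorem eventually_linearIndependent {ι τ : Type*} [Finite ι] [Finite τ]
    {f : ι → τ → MvPolynomial σ K} (hf : LinearIndependent (RationalFunctionField Y)
      fun k i => aeval (genericCoordinates Y) (f k i)) :
    ∀ᶠ p in generalPoints Y, LinearIndependent K fun k i => eval p (f k i) := by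
  classical
  have := Fintype.ofFinite ι
  have := Fintype.ofFinite τ
  obtain ⟨φ, hφ⟩ := exists_dual_apply_eq_ite hf
  obtain ⟨Q, hQ, P, hP⟩ := exists_aeval_genericCoordinates_eq_mul
    fun ki : ι × τ => φ ki.1 fun j => if ki.2 = j then 1 else 0
  have hmem : ∀ k l, ∑ i, P (k, i) * f l i - (if k = l then Q else 0) ∈ vanishingIdeal K Y := by
    intro k l
    rw [← aeval_genericCoordinates_eq_zero_iff, map_sub, sub_eq_zero, map_sum]
    simp only [map_mul, hP, mul_assoc, ← Finset.mul_sum]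
    have hφkl := hφ k l
    rw [LinearMap.pi_apply_eq_sum_univ (φ k)] at hφkl
    simp only [smul_eq_mul, mul_comm (aeval (genericCoordinates Y) (f l _))] at hφkl
    rw [hφkl, mul_ite, mul_one, mul_zero, apply_ite (aeval (genericCoordinates Y)), map_zero]
  filter_upwards [eventually_generalPoints_mem, eventually_generalPoints_eval_ne_zero hQ]
    with p hp hQp
  refine Fintype.linearIndependent_iff.mpr fun c hc k => ?_
  have hdual : ∀ l, ∑ i, eval p (P (k, i)) * eval p (f l i) = if k = l then eval p Q else 0 := by
    intro l
    have := mem_vanishingIdeal_iff.mp (hmem k l) p hp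
    simpa [sub_eq_zero, apply_ite (eval p)] using this
  have hcQ : c k * eval p Q = 0 :=
    calc c k * eval p Q = ∑ l, c l * ∑ i, eval p (P (k, i)) * eval p (f l i) := by simp [hdual]
      _ = ∑ i, eval p (P (k, i)) * ∑ l, c l * eval p (f l i) := by
          simp only [Finset.mul_sum]
          rw [Finset.sum_comm]
          exact Finset.sum_congr rfl fun _ _ => Finset.sum_congr rfl fun _ _ => by ring
      _ = 0 := Finset.sum_eq_zero fun i _ => by
          have := congrFun hc i
          simp only [Finset.sum_apply, Pi.smul_apply, smul_eq_mul, Pi.zero_apply] at this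
          rw [this, mul_zero]
  exact (mul_eq_zero.mp hcQ).resolve_right hQp

theorem eventually_le_finrank_solutionSpace (S : Set (τ → MvPolynomial σ K)) :
    ∀ᶠ p in generalPoints Y,
      finrank (RationalFunctionField Y) (solutionSpace S (genericCoordinates Y)) ≤
        finrank K (solutionSpace S p) := by
  let v := finBasis (RationalFunctionField Y) (solutionSpace S (genericCoordinates Y))
  obtain ⟨Q, hQ, P, hP⟩ := exists_aeval_genericCoordinates_eq_mul
    fun ki : Fin _ × τ => (v ki.1 : τ → RationalFunctionField Y) ki.2
  have hQ0 : aeval (genericCoordinates Y) Q ≠ 0 := mt aeval_genericCoordinates_eq_zero_iff.mp hQ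
  have hPv : (fun k i => aeval (genericCoordinates Y) (P (k, i))) =
      fun k => aeval (genericCoordinates Y) Q • (v k : τ → RationalFunctionField Y) :=
    funext fun k => funext fun i => hP (k, i)
  have hli : LinearIndependent (RationalFunctionField Y)
      fun k i => aeval (genericCoordinates Y) (P (k, i)) := by
    rw [hPv]
    exact (v.linearIndependent.map' _ (Submodule.ker_subtype _)).units_smul
      fun _ => Units.mk0 _ hQ0
  filter_upwards [eventually_generalPoints_mem,
    eventually_linearIndependent (f := fun k i => P (k, i)) hli] with p hp hlip
  have hsol : ∀ k, (fun i => eval p (P (k, i))) ∈ solutionSpace S p := by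
    intro k f hf
    have hmem : ∑ i, f i * P (k, i) ∈ vanishingIdeal K Y := by
      rw [← aeval_genericCoordinates_eq_zero_iff, map_sum]
      simp only [map_mul, hP, mul_left_comm _ (aeval (genericCoordinates Y) Q), ← Finset.mul_sum]
      rw [(v k).2 f hf, mul_zero]
    simpa using mem_vanishingIdeal_iff.mp hmem p hp
  have hli' : LinearIndependent K fun k => (⟨_, hsol k⟩ : solutionSpace S p) :=
    LinearIndependent.of_comp (solutionSpace S p).subtype hlip
  simpa using hli'.fintype_card_le_finrank

theorem eventually_finrank_solutionSpace_eq (S : Set (τ → MvPolynomial σ K)) :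
    ∀ᶠ p in generalPoints Y, finrank K (solutionSpace S p) =
      finrank (RationalFunctionField Y) (solutionSpace S (genericCoordinates Y)) := by
  obtain ⟨m, f, hfS, hli, hf⟩ := exists_linearIndependent_solutionSpace_eq S (genericCoordinates Y)
  filter_upwards [eventually_le_finrank_solutionSpace S, eventually_linearIndependent hli]
    with p hp hlip
  refine le_antisymm ?_ hp
  have hle : solutionSpace S p ≤ solutionSpace (Set.range f) p := fun v hv g hg => hv g (hfS hg)
  have hfinrank := Submodule.finrank_mono hle
  have hgen := finrank_solutionSpace_range_add_card hli
  have hspecial := finrank_solutionSpace_range_add_card (y := p) hlip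
  rw [hf] at hgen
  omega

end GenericRank

section Jacobian

variable {K : Type*} [Field K] {E : Type*} [Field E] [Algebra K E] {σ τ : Type*}

/-- The Jacobian matrix at `y` of the polynomial map with components `φ`. -/
def jacobian (φ : τ → MvPolynomial σ K) (y : σ → E) : Matrix τ σ E :=
  Matrix.of fun j i => aeval y (pderiv i (φ j))

theorem aeval_pderiv_bind₁ [Fintype τ] (φ : τ → MvPolynomial σ K) (y : σ → E)
    (F : MvPolynomial τ K) (i : σ) : aeval y (pderiv i (bind₁ φ F)) =
      ∑ j, aeval (fun j => aeval y (φ j)) (pderiv j F) * jacobian φ y j i := by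
  classical
  induction F using MvPolynomial.induction_on with
  | C c => simp
  | add p q hp hq => simp only [map_add, hp, hq, add_mul, Finset.sum_add_distrib]
  | mul_X p j hp =>
    simp [Derivation.leibniz, hp, pderiv_X, Pi.single_apply, add_mul, Finset.sum_add_distrib,
      Finset.mul_sum, mul_assoc, apply_ite, aeval_bind₁, jacobian]

theorem solutionSpace_image_bind₁ {ι : Type*} [Fintype ι] (S : Set (ι → MvPolynomial τ K))
    (φ : τ → MvPolynomial σ K) (y : σ → E) :
    solutionSpace ((fun f i => bind₁ φ (f i)) '' S) y =
      solutionSpace S fun j => aeval y (φ j) := by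
  ext v
  refine Set.forall_mem_image.trans (forall₂_congr fun f _ => ?_)
  simp only [aeval_bind₁]

variable [Fintype σ]

theorem map_jacobian_le [Fintype τ] {φ : τ → MvPolynomial σ K} {I : Ideal (MvPolynomial σ K)}
    {J : Ideal (MvPolynomial τ K)} (h : ∀ F ∈ J, bind₁ φ F ∈ I) (y : σ → E) :
    (solutionSpace (gradients I) y).map (jacobian φ y).mulVecLin ≤
      solutionSpace (gradients J) fun j => aeval y (φ j) := by
  rintro _ ⟨v, hv, rfl⟩
  refine mem_solutionSpace_gradients.mpr fun F hF => ?_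
  rw [← mem_solutionSpace_gradients.mp hv _ (h F hF)]
  simp only [aeval_pderiv_bind₁, Matrix.mulVecLin_apply, Matrix.mulVec, dotProduct, Finset.mul_sum,
    Finset.sum_mul, mul_assoc]
  exact Finset.sum_comm

theorem map_jacobian_eq [Fintype τ] [CharZero K] [Algebra.EssFiniteType K E]
    (φ : τ → MvPolynomial σ K) (y : σ → E) :
    (solutionSpace (gradients (RingHom.ker (aeval (R := K) y))) y).map (jacobian φ y).mulVecLin =
      solutionSpace (gradients (RingHom.ker (aeval (R := K) fun j => aeval y (φ j))))
        fun j => aeval y (φ j) := by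
  refine le_antisymm (map_jacobian_le (fun F hF => ?_) y) fun w hw => ?_
  · rw [RingHom.mem_ker, aeval_bind₁]
    exact hF
  · obtain ⟨D, hD⟩ := exists_derivation_of_mem_solutionSpace hw
    refine ⟨_, (derivationEval (K := K) y D).2, funext fun j => ?_⟩
    rw [← hD j, derivation_aeval]
    rfl

theorem solutionSpace_union_range_pderiv (S : Set (σ → MvPolynomial σ K))
    (φ : τ → MvPolynomial σ K) (y : σ → E) :
    solutionSpace (S ∪ Set.range fun j i => pderiv i (φ j)) y =
      solutionSpace S y ⊓ LinearMap.ker (jacobian φ y).mulVecLin := by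
  ext v
  rw [Submodule.mem_inf, LinearMap.mem_ker, Matrix.mulVecLin_apply, funext_iff]
  refine ⟨fun h => ⟨fun f hf => h f (.inl hf), fun j => h _ (.inr ⟨j, rfl⟩)⟩, ?_⟩
  rintro ⟨hS, hφ⟩ _ (hf | ⟨j, rfl⟩)
  exacts [hS _ hf, hφ j]

end Jacobian

section GenericSmoothness

variable {K : Type*} [Field K] [CharZero K] {σ τ : Type*} [Fintype σ] [Fintype τ]
  {Y : Set (σ → K)} [hY : (vanishingIdeal K Y).IsPrime]

theorem affineTangent_eq_solutionSpace {K : Type*} [Field K] (Y : Set (σ → K)) (p : σ → K) :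
    affineTangent Y p = solutionSpace (gradients (vanishingIdeal K Y)) p :=
  Submodule.ext fun _ => mem_solutionSpace_gradients.symm

instance essFiniteType_rationalFunctionField {K σ : Type*} [Field K] [Finite σ] (Y : Set (σ → K)) :
    Algebra.EssFiniteType K (RationalFunctionField Y) :=
  have : Algebra.EssFiniteType (MvPolynomial σ K ⧸ vanishingIdeal K Y) (RationalFunctionField Y) :=
    .of_isLocalization _ (nonZeroDivisors _)
  .comp K (MvPolynomial σ K ⧸ vanishingIdeal K Y) _

instance isAlgebraic_rationalFunctionField {K σ : Type*} [Field K] (Y : Set (σ → K))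
    [(vanishingIdeal K Y).IsPrime] :
    Algebra.IsAlgebraic (Algebra.adjoin K (Set.range (genericCoordinates Y)))
      (RationalFunctionField Y) := by
  have hA : ∀ a, IsAlgebraic (Algebra.adjoin K (Set.range (genericCoordinates Y)))
      (algebraMap (MvPolynomial σ K ⧸ vanishingIdeal K Y) (RationalFunctionField Y) a) := by
    intro a
    obtain ⟨P, rfl⟩ := Ideal.Quotient.mk_surjective a
    have hmem : aeval (genericCoordinates Y) P ∈
        Algebra.adjoin K (Set.range (genericCoordinates Y)) := by
      rw [Algebra.adjoin_range_eq_range_aeval]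
      exact ⟨P, rfl⟩
    rw [← aeval_genericCoordinates]
    exact isAlgebraic_algebraMap
      (⟨_, hmem⟩ : Algebra.adjoin K (Set.range (genericCoordinates Y)))
  refine ⟨fun x => ?_⟩
  obtain ⟨a, b, -, rfl⟩ := IsFractionRing.div_surjective (MvPolynomial σ K ⧸ vanishingIdeal K Y) x
  rw [div_eq_mul_inv]
  exact (hA a).mul (hA b).inv

theorem eventually_finrank_affineTangent {d : ℕ}
    (hd : Algebra.trdeg K (MvPolynomial σ K ⧸ vanishingIdeal K Y) = d) :
    ∀ᶠ p in generalPoints Y, finrank K (affineTangent Y p) = d := by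
  have hE : Algebra.trdeg K (RationalFunctionField Y) = d := by
    have : Algebra.IsAlgebraic (MvPolynomial σ K ⧸ vanishingIdeal K Y) (RationalFunctionField Y) :=
      IsLocalization.isAlgebraic _ (nonZeroDivisors _)
    rw [← trdeg_add_eq K (MvPolynomial σ K ⧸ vanishingIdeal K Y),
      trdeg_eq_zero (R := MvPolynomial σ K ⧸ vanishingIdeal K Y), add_zero, hd]
  have hgen := finrank_solutionSpace_gradients_eq (genericCoordinates Y) hE
  rw [ker_aeval_genericCoordinates] at hgen
  filter_upwards [eventually_finrank_solutionSpace_eq (gradients (vanishingIdeal K Y))] with p hp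
  rw [affineTangent_eq_solutionSpace, hp, hgen]

variable {Z : Set (τ → K)} {φ : τ → MvPolynomial σ K}

/-- Generic smoothness: the three spaces involved are solution spaces, which keep their generic
dimension at the general point, and over the function field of `Y` derivations extend. -/
theorem eventually_map_affineTangent_eq (hφ : ∀ p ∈ Y, (fun j => eval p (φ j)) ∈ Z)
    (hdom : ∀ F, bind₁ φ F ∈ vanishingIdeal K Y → F ∈ vanishingIdeal K Z) :
    ∀ᶠ p in generalPoints Y, (affineTangent Y p).map (jacobian φ p).mulVecLin =
      affineTangent Z fun j => eval p (φ j) := by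
  have hker : RingHom.ker (aeval (R := K) fun j => aeval (genericCoordinates Y) (φ j)) =
      vanishingIdeal K Z := by
    ext F
    rw [RingHom.mem_ker, ← aeval_bind₁, aeval_genericCoordinates_eq_zero_iff]
    exact ⟨hdom F, bind₁_mem_vanishingIdeal hφ⟩
  have hgen := map_jacobian_eq φ (genericCoordinates Y)
  rw [hker, ker_aeval_genericCoordinates] at hgen
  filter_upwards [eventually_finrank_solutionSpace_eq (gradients (vanishingIdeal K Y)),
    eventually_finrank_solutionSpace_eq
      ((fun f i => bind₁ φ (f i)) '' gradients (vanishingIdeal K Z)),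
    eventually_finrank_solutionSpace_eq
      (gradients (vanishingIdeal K Y) ∪ Set.range fun j i => pderiv i (φ j))] with p hpY hpZ hpker
  rw [solutionSpace_image_bind₁, solutionSpace_image_bind₁, ← hgen] at hpZ
  rw [solutionSpace_union_range_pderiv, solutionSpace_union_range_pderiv] at hpker
  rw [affineTangent_eq_solutionSpace, affineTangent_eq_solutionSpace]
  refine Submodule.eq_of_le_of_finrank_eq
    (map_jacobian_le (fun _ => bind₁_mem_vanishingIdeal hφ) p) (hpZ ▸ ?_)
  have h := finrank_map_add_finrank_inf_ker (jacobian φ p).mulVecLin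
    (solutionSpace (gradients (vanishingIdeal K Y)) p)
  have hE := finrank_map_add_finrank_inf_ker (jacobian φ (genericCoordinates Y)).mulVecLin
    (solutionSpace (gradients (vanishingIdeal K Y)) (genericCoordinates Y))
  omega

end GenericSmoothness

section AffineTangent

variable {K : Type*} [Field K] {σ τ : Type*}

theorem notMem_vanishingIdeal_iff {Y : Set (σ → K)} {Q : MvPolynomial σ K} :
    Q ∉ vanishingIdeal K Y ↔ ∃ p ∈ Y, eval p Q ≠ 0 := by
  simp [mem_vanishingIdeal_iff, aeval_eq_eval]

theorem isPrime_vanishingIdeal_of_dominant {Y : Set (σ → K)} [(vanishingIdeal K Y).IsPrime]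
    {Z : Set (τ → K)} {φ : τ → MvPolynomial σ K} (hφ : ∀ p ∈ Y, (fun j => eval p (φ j)) ∈ Z)
    (hdom : ∀ F, bind₁ φ F ∈ vanishingIdeal K Y → F ∈ vanishingIdeal K Z) :
    (vanishingIdeal K Z).IsPrime := by
  have hZ : vanishingIdeal K Z = (vanishingIdeal K Y).comap (bind₁ φ) :=
    le_antisymm (fun F hF => bind₁_mem_vanishingIdeal hφ hF) hdom
  exact hZ ▸ Ideal.comap_isPrime _ _

theorem vanishingIdeal_univ [Infinite K] : vanishingIdeal K (Set.univ : Set (σ → K)) = ⊥ :=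
  (Submodule.eq_bot_iff _).mpr fun F hF => MvPolynomial.funext fun x => by
    rw [map_zero]
    exact mem_vanishingIdeal_iff.mp hF x trivial

instance isPrime_vanishingIdeal_univ [Infinite K] :
    (vanishingIdeal K (Set.univ : Set (σ → K))).IsPrime :=
  vanishingIdeal_univ (K := K) (σ := σ) ▸ Ideal.isPrime_bot

variable [Fintype σ]

theorem affineTangent_univ [Infinite K] (p : σ → K) : affineTangent Set.univ p = ⊤ := by
  refine eq_top_iff.mpr fun v _ F hF => ?_
  rw [vanishingIdeal_univ, Ideal.mem_bot] at hF
  simp [hF]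

theorem eval_mkDerivation_C (p v : σ → K) (F : MvPolynomial σ K) :
    eval p (mkDerivation K (fun i => C (v i)) F) = ∑ i, eval p (pderiv i F) * v i := by
  have h := derivation_aeval (mkDerivation K fun i => (C (v i) : MvPolynomial σ K)) X F
  rw [aeval_X_left_apply] at h
  simp [h]

theorem jacobian_mulVec (φ : τ → MvPolynomial σ K) (p v : σ → K) :
    (jacobian φ p).mulVec v = fun j => eval p (mkDerivation K (fun i => C (v i)) (φ j)) :=
  funext fun j => (eval_mkDerivation_C p v (φ j)).symm

theorem jacobian_mulVec_mem_affineTangent [Fintype τ] {Y : Set (σ → K)} {Z : Set (τ → K)}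
    {φ : τ → MvPolynomial σ K} (hφ : ∀ p ∈ Y, (fun j => eval p (φ j)) ∈ Z) {p v : σ → K}
    (hv : v ∈ affineTangent Y p) :
    (jacobian φ p).mulVec v ∈ affineTangent Z fun j => eval p (φ j) := by
  rw [affineTangent_eq_solutionSpace] at hv ⊢
  exact map_jacobian_le (fun _ => bind₁_mem_vanishingIdeal hφ) p (Submodule.mem_map_of_mem hv)

end AffineTangent

section AffineProd

variable {K : Type*} [Field K] {σ τ : Type*}

/-- The product `Y × Z` as a set of points of the affine space with coordinates `σ ⊕ τ`. -/
def affineProd (Y : Set (σ → K)) (Z : Set (τ → K)) : Set (σ ⊕ τ → K) :=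
  {p | p ∘ Sum.inl ∈ Y ∧ p ∘ Sum.inr ∈ Z}

theorem eval_bind₁_elim_X_C (s : σ → K) (w : τ → K) (Q : MvPolynomial (σ ⊕ τ) K) :
    eval s (bind₁ (Sum.elim X (C ∘ w)) Q) = eval (Sum.elim s w) Q := by
  rw [eval_bind₁]
  congr 2
  ext (i | i) <;> simp

theorem eval_bind₁_elim_C_X (s : σ → K) (w : τ → K) (Q : MvPolynomial (σ ⊕ τ) K) :
    eval w (bind₁ (Sum.elim (C ∘ s) X) Q) = eval (Sum.elim s w) Q := by
  rw [eval_bind₁]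
  congr 2
  ext (i | i) <;> simp

variable {Y : Set (σ → K)} {Z : Set (τ → K)} [hY : (vanishingIdeal K Y).IsPrime]
  [hZ : (vanishingIdeal K Z).IsPrime]

theorem eventually_eventually_eval_elim_ne_zero {Q : MvPolynomial (σ ⊕ τ) K}
    (hQ : Q ∉ vanishingIdeal K (affineProd Y Z)) :
    ∀ᶠ w in generalPoints Z, ∀ᶠ s in generalPoints Y, eval (Sum.elim s w) Q ≠ 0 := by
  obtain ⟨p, ⟨hpY, hpZ⟩, hp⟩ := notMem_vanishingIdeal_iff.mp hQ
  rw [← Sum.elim_comp_inl_inr p] at hp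
  have hG : bind₁ (Sum.elim (C ∘ p ∘ Sum.inl) X) Q ∉ vanishingIdeal K Z :=
    notMem_vanishingIdeal_iff.mpr ⟨_, hpZ, by rwa [eval_bind₁_elim_C_X]⟩
  filter_upwards [eventually_generalPoints_eval_ne_zero hG] with w hw
  rw [eval_bind₁_elim_C_X, ← eval_bind₁_elim_X_C] at hw
  filter_upwards [eventually_generalPoints_eval_ne_zero
    (notMem_vanishingIdeal_iff.mpr ⟨_, hpY, hw⟩)] with s hs
  rwa [eval_bind₁_elim_X_C] at hs

instance isPrime_vanishingIdeal_affineProd : (vanishingIdeal K (affineProd Y Z)).IsPrime := by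
  refine Ideal.isPrime_iff.mpr ⟨fun htop => ?_, fun {P Q} hPQ => ?_⟩
  · obtain ⟨s, hs⟩ := (eventually_generalPoints_mem (Y := Y)).exists
    obtain ⟨w, hw⟩ := (eventually_generalPoints_mem (Y := Z)).exists
    have h1 := mem_vanishingIdeal_iff.mp ((Ideal.eq_top_iff_one _).mp htop) (Sum.elim s w) ⟨hs, hw⟩
    simp at h1
  · by_contra! h
    obtain ⟨w, hwZ, hP, hQ⟩ := (eventually_generalPoints_mem.and
      ((eventually_eventually_eval_elim_ne_zero h.1).and
        (eventually_eventually_eval_elim_ne_zero h.2))).exists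
    obtain ⟨s, hsY, hPs, hQs⟩ := (eventually_generalPoints_mem.and (hP.and hQ)).exists
    refine mul_ne_zero hPs hQs ?_
    rw [← map_mul]
    exact mem_vanishingIdeal_iff.mp hPQ _ ⟨hsY, hwZ⟩

theorem eventually_eventually_generalPoints {P : (σ ⊕ τ → K) → Prop}
    (h : ∀ᶠ p in generalPoints (affineProd Y Z), P p) :
    ∀ᶠ w in generalPoints Z, ∀ᶠ s in generalPoints Y, P (Sum.elim s w) := by
  obtain ⟨Q, hQ, h⟩ := eventually_generalPoints.mp h
  filter_upwards [eventually_eventually_eval_elim_ne_zero hQ, eventually_generalPoints_mem]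
    with w hw hwZ
  filter_upwards [hw, eventually_generalPoints_mem] with s hs hsY
  exact h _ ⟨hsY, hwZ⟩ hs

omit hY hZ in
theorem mem_affineTangent_affineProd [Fintype σ] [Fintype τ] {p v : σ ⊕ τ → K}
    (hp : p ∈ affineProd Y Z) : v ∈ affineTangent (affineProd Y Z) p ↔
      v ∘ Sum.inl ∈ affineTangent Y (p ∘ Sum.inl) ∧
        v ∘ Sum.inr ∈ affineTangent Z (p ∘ Sum.inr) := by
  refine ⟨fun hv => ⟨?_, ?_⟩, fun ⟨hY, hZ⟩ => ?_⟩
  · simpa [jacobian_mulVec, Function.comp_def] using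
      jacobian_mulVec_mem_affineTangent (φ := X ∘ Sum.inl) (fun q hq => by simpa using! hq.1) hv
  · simpa [jacobian_mulVec, Function.comp_def] using
      jacobian_mulVec_mem_affineTangent (φ := X ∘ Sum.inr) (fun q hq => by simpa using! hq.2) hv
  · have h₁ := jacobian_mulVec_mem_affineTangent (Z := affineProd Y Z)
      (φ := Sum.elim X (C ∘ p ∘ Sum.inr))
      (fun s hs => ⟨by simpa [Function.comp_def] using hs,
        by simpa [Function.comp_def] using hp.2⟩) hY
    have h₂ := jacobian_mulVec_mem_affineTangent (Z := affineProd Y Z)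
      (φ := Sum.elim (C ∘ p ∘ Sum.inl) X)
      (fun w hw => ⟨by simpa [Function.comp_def] using hp.1,
        by simpa [Function.comp_def] using hw⟩) hZ
    have hadd : v = Sum.elim (v ∘ Sum.inl) (0 : τ → K) + Sum.elim (0 : σ → K) (v ∘ Sum.inr) := by
      ext (i | i) <;> simp
    rw [hadd]
    refine add_mem ?_ ?_
    · convert h₁ using 2 <;> ext (i | i) <;> simp [jacobian_mulVec]
    · convert h₂ using 2 <;> ext (i | i) <;> simp [jacobian_mulVec]

end AffineProd

section Cone

variable {K : Type*} [Field K] {σ : Type*}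

theorem eval_smul_of_isHomogeneous {F : MvPolynomial σ K} {d : ℕ} (hF : F.IsHomogeneous d) (c : K)
    (w : σ → K) : eval (c • w) F = c ^ d * eval w F := by
  rw [eval_eq, eval_eq, Finset.mul_sum]
  refine Finset.sum_congr rfl fun m hm => ?_
  have hdeg : ∑ i ∈ m.support, m i = d := by
    simpa [Finsupp.weight_apply, Finsupp.sum] using hF (mem_support_iff.mp hm)
  simp only [Pi.smul_apply, smul_eq_mul, mul_pow, Finset.prod_mul_distrib,
    Finset.prod_pow_eq_pow_sum, hdeg]
  ring

theorem eval_homogeneousComponent_eq_zero [Infinite K] {F : MvPolynomial σ K} {w : σ → K}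
    (h : ∀ c : K, c ≠ 0 → eval (c • w) F = 0) (d : ℕ) : eval w (homogeneousComponent d F) = 0 := by
  let q : Polynomial K := ∑ d ∈ Finset.range (F.totalDegree + 1),
    Polynomial.monomial d (eval w (homogeneousComponent d F))
  have heval : ∀ c, q.eval c = eval (c • w) F := fun c => by
    conv_rhs => rw [← sum_homogeneousComponent F, map_sum]
    rw [Polynomial.eval_finsetSum]
    refine Finset.sum_congr rfl fun d _ => ?_
    rw [eval_smul_of_isHomogeneous (homogeneousComponent_isHomogeneous d F),
      Polynomial.eval_monomial, mul_comm]
  have hq : q = 0 := Polynomial.eq_zero_of_infinite_isRoot q <|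
    (Set.finite_singleton (0 : K)).infinite_compl.mono fun c hc => (heval c).trans (h c hc)
  by_cases hd : F.totalDegree < d
  · rw [homogeneousComponent_eq_zero _ _ hd, map_zero]
  · have hcoeff := congrArg (Polynomial.coeff · d) hq
    simpa [q, Polynomial.finsetSum_coeff, Polynomial.coeff_monomial, Nat.lt_succ_iff,
      not_lt.mp hd] using hcoeff

theorem homogeneousComponent_mem_vanishingIdeal [Infinite K] {Y : Set (σ → K)}
    (hY : ∀ c : K, c ≠ 0 → ∀ w ∈ Y, c • w ∈ Y) {F : MvPolynomial σ K} (hF : F ∈ vanishingIdeal K Y)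
    (d : ℕ) : homogeneousComponent d F ∈ vanishingIdeal K Y :=
  mem_vanishingIdeal_iff.mpr fun w hw => eval_homogeneousComponent_eq_zero
    (fun c hc => mem_vanishingIdeal_iff.mp hF _ (hY c hc w hw)) d

variable [Fintype σ]

theorem smul_mem_affineTangent_smul {Y : Set (σ → K)} {c : K} (hY : ∀ w ∈ Y, c • w ∈ Y)
    {w v : σ → K} (hv : v ∈ affineTangent Y w) : c • v ∈ affineTangent Y (c • w) := by
  have h := jacobian_mulVec_mem_affineTangent (φ := fun i => C c * X i)
    (fun p hp => by simpa using! hY p hp) hv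
  convert h using 2 <;> ext <;> simp [jacobian_mulVec]

theorem self_mem_affineTangent [Infinite K] {Y : Set (σ → K)}
    (hY : ∀ c : K, c ≠ 0 → ∀ w ∈ Y, c • w ∈ Y) {w : σ → K} (hw : w ∈ Y) :
    w ∈ affineTangent Y w := by
  intro F hF
  rw [← eval_mkDerivation_C, ← sum_homogeneousComponent F, map_sum, map_sum]
  refine Finset.sum_eq_zero fun d _ => ?_
  have heuler := congrArg (eval w)
    (homogeneousComponent_isHomogeneous d F).sum_X_mul_pderiv
  have hvanish : eval w (homogeneousComponent d F) = 0 :=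
    mem_vanishingIdeal_iff.mp (homogeneousComponent_mem_vanishingIdeal hY hF d) w hw
  rw [map_nsmul, hvanish, smul_zero, map_sum] at heuler
  rw [eval_mkDerivation_C, ← heuler]
  simp [mul_comm]

end Cone

section Plucker

variable {K : Type*} [Field K] {N : ℕ}

theorem plucker_smul_add (u v : Fin (N + 1) → K) (a b c d : K) :
    plucker (a • u + b • v) (c • u + d • v) = (a * d - b * c) • plucker u v := by
  funext ij
  simp only [plucker, Pi.add_apply, Pi.smul_apply, smul_eq_mul]
  ring

theorem plucker_smul_add_deriv (u v u' v' : Fin (N + 1) → K) (a b c d : K) :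
    plucker (a • u' + b • v') (c • u + d • v) + plucker (a • u + b • v) (c • u' + d • v') =
      (a * d - b * c) • (plucker u' v + plucker u v') := by
  funext ij
  simp only [plucker, Pi.add_apply, Pi.smul_apply, smul_eq_mul]
  ring

/-- The interior product `s ⌟ w` of a covector `s` and a bivector `w`. -/
def interiorProduct {A : Type*} [CommRing A] (s : Fin (N + 1) → A)
    (w : Fin (N + 1) × Fin (N + 1) → A) : Fin (N + 1) → A :=
  fun i => ∑ j, s j * w (j, i)

theorem interiorProduct_zero (s : Fin (N + 1) → K) :
    interiorProduct s (0 : Fin (N + 1) × Fin (N + 1) → K) = 0 := by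
  funext i
  simp [interiorProduct]

theorem interiorProduct_add (s : Fin (N + 1) → K) (w w' : Fin (N + 1) × Fin (N + 1) → K) :
    interiorProduct s (w + w') = interiorProduct s w + interiorProduct s w' := by
  funext i
  simp [interiorProduct, mul_add, Finset.sum_add_distrib]

theorem interiorProduct_plucker (s u v : Fin (N + 1) → K) :
    interiorProduct s (plucker u v) = -(s ⬝ᵥ v) • u + (s ⬝ᵥ u) • v := by
  funext i
  simp only [interiorProduct, plucker, dotProduct, Pi.add_apply, Pi.smul_apply, smul_eq_mul,
    neg_mul, Finset.sum_mul, ← Finset.sum_neg_distrib, ← Finset.sum_add_distrib]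
  exact Finset.sum_congr rfl fun j _ => by ring

theorem plucker_interiorProduct (s t u v : Fin (N + 1) → K) :
    plucker (interiorProduct s (plucker u v)) (interiorProduct t (plucker u v)) =
      (interiorProduct s (plucker u v) ⬝ᵥ t) • plucker u v := by
  rw [interiorProduct_plucker, interiorProduct_plucker, plucker_smul_add]
  congr 1
  rw [add_dotProduct, smul_dotProduct, smul_dotProduct, dotProduct_comm u, dotProduct_comm v,
    smul_eq_mul, smul_eq_mul]
  ring

end Plucker

namespace ProjLine

variable {K : Type*} [Field K] {N : ℕ} (r : ProjLine K N)

theorem exists_dotProduct_eq (b : Basis (Fin 2) K r.hat) (y₀ y₁ : K) :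
    ∃ s : Fin (N + 1) → K, s ⬝ᵥ (b 0 : Fin (N + 1) → K) = y₀ ∧
      s ⬝ᵥ (b 1 : Fin (N + 1) → K) = y₁ := by
  obtain ⟨f, hf⟩ := LinearMap.exists_extend (b.constr K ![y₀, y₁])
  refine ⟨(dotProductEquiv K _).symm f, ?_⟩
  have h : ∀ a, (dotProductEquiv K _).symm f ⬝ᵥ (b a : Fin (N + 1) → K) = ![y₀, y₁] a := by
    intro a
    rw [← dotProductEquiv_apply_apply, LinearEquiv.apply_symm_apply, ← b.constr_basis K ![y₀, y₁],
      ← hf]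
    rfl
  exact ⟨h 0, h 1⟩

theorem interiorProduct_pluckerVec (b : Basis (Fin 2) K r.hat) (s : Fin (N + 1) → K) :
    interiorProduct s (r.pluckerVec b) =
      -(s ⬝ᵥ (b 1 : Fin (N + 1) → K)) • (b 0 : Fin (N + 1) → K) +
        (s ⬝ᵥ (b 0 : Fin (N + 1) → K)) • (b 1 : Fin (N + 1) → K) :=
  interiorProduct_plucker _ _ _

/-- The interior product with a Plücker vector of a line takes values in the line. -/
def sweep (b : Basis (Fin 2) K r.hat) (s : Fin (N + 1) → K) : r.hat :=
  -(s ⬝ᵥ (b 1 : Fin (N + 1) → K)) • b 0 + (s ⬝ᵥ (b 0 : Fin (N + 1) → K)) • b 1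

theorem coe_sweep (b : Basis (Fin 2) K r.hat) (s : Fin (N + 1) → K) :
    (r.sweep b s : Fin (N + 1) → K) = interiorProduct s (r.pluckerVec b) :=
  (r.interiorProduct_pluckerVec b s).symm

theorem sweep_surjective (b : Basis (Fin 2) K r.hat) : Function.Surjective (r.sweep b) := by
  intro x
  obtain ⟨s, h₀, h₁⟩ := r.exists_dotProduct_eq b (b.repr x 1) (-b.repr x 0)
  refine ⟨s, ?_⟩
  rw [sweep, h₀, h₁, neg_neg, ← Fin.sum_univ_two fun a => b.repr x a • b a, b.sum_repr]

theorem pluckerVec_ne_zero (b : Basis (Fin 2) K r.hat) : r.pluckerVec b ≠ 0 := by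
  intro h0
  obtain ⟨s, hs⟩ := r.sweep_surjective b (b 0)
  refine b.ne_zero 0 (Subtype.ext ?_)
  rw [← hs, coe_sweep, h0, interiorProduct_zero, Submodule.coe_zero]

theorem exists_basis : Nonempty (Basis (Fin 2) K r.hat) :=
  ⟨finBasisOfFinrankEq K _ r.finrank_hat⟩

/-- The derivative `ℓ(b₀) ∧ b₁ + b₀ ∧ ℓ(b₁)` of the Plücker vector along the first order
deformation `ℓ` of the line. -/
def pluckerDeriv (b : Basis (Fin 2) K r.hat) :
    (r.hat →ₗ[K] (Fin (N + 1) → K)) →ₗ[K] (Fin (N + 1) × Fin (N + 1) → K) where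
  toFun ℓ := plucker (ℓ (b 0)) (b 1) + plucker (b 0) (ℓ (b 1))
  map_add' ℓ m := by
    funext ij
    simp only [plucker, LinearMap.add_apply, Pi.add_apply]
    ring
  map_smul' c ℓ := by
    funext ij
    simp only [plucker, LinearMap.smul_apply, Pi.smul_apply, Pi.add_apply, smul_eq_mul,
      RingHom.id_apply]
    ring

theorem pluckerDeriv_apply (b : Basis (Fin 2) K r.hat) (ℓ : r.hat →ₗ[K] (Fin (N + 1) → K)) :
    r.pluckerDeriv b ℓ = plucker (ℓ (b 0)) (b 1) + plucker (b 0) (ℓ (b 1)) :=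
  rfl

theorem interiorProduct_pluckerDeriv (b : Basis (Fin 2) K r.hat)
    (ℓ : r.hat →ₗ[K] (Fin (N + 1) → K)) (s : Fin (N + 1) → K) :
    interiorProduct s (r.pluckerDeriv b ℓ) - ℓ (r.sweep b s) ∈ r.hat := by
  have h : interiorProduct s (r.pluckerDeriv b ℓ) - ℓ (r.sweep b s) =
      (((s ⬝ᵥ ℓ (b 0)) • b 1 - (s ⬝ᵥ ℓ (b 1)) • b 0 : r.hat) : Fin (N + 1) → K) := by
    rw [pluckerDeriv_apply, interiorProduct_add, interiorProduct_plucker, interiorProduct_plucker,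
      sweep, map_add, map_smul, map_smul, Submodule.coe_sub, Submodule.coe_smul,
      Submodule.coe_smul]
    module
  exact h ▸ Subtype.prop _

theorem exists_pluckerVec_eq_smul (b b' : Basis (Fin 2) K r.hat) :
    ∃ c : K, c ≠ 0 ∧ r.pluckerVec b' = c • r.pluckerVec b ∧
      ∀ ℓ, r.pluckerDeriv b' ℓ = c • r.pluckerDeriv b ℓ := by
  have hb' : ∀ a, b' a = b.repr (b' a) 0 • b 0 + b.repr (b' a) 1 • b 1 := fun a => by
    rw [← Fin.sum_univ_two fun i => b.repr (b' a) i • b i, b.sum_repr]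
  have hvec : r.pluckerVec b' = (b.repr (b' 0) 0 * b.repr (b' 1) 1 -
      b.repr (b' 0) 1 * b.repr (b' 1) 0) • r.pluckerVec b := by
    rw [pluckerVec, pluckerVec, ← plucker_smul_add]
    congr 1 <;> exact congrArg Subtype.val (hb' _)
  refine ⟨_, fun hdet => r.pluckerVec_ne_zero b' ?_, hvec, fun ℓ => ?_⟩
  · rw [hvec, hdet, zero_smul]
  · rw [pluckerDeriv_apply, pluckerDeriv_apply, ← plucker_smul_add_deriv]
    congr 2 <;> first
      | exact (congrArg ℓ (hb' _)).trans (by rw [map_add, map_smul, map_smul])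
      | exact congrArg Subtype.val (hb' _)

theorem exists_basis_smul (b : Basis (Fin 2) K r.hat) {c : K} (hc : c ≠ 0) :
    ∃ b' : Basis (Fin 2) K r.hat, r.pluckerVec b' = c • r.pluckerVec b := by
  refine ⟨b.unitsSMul ![Units.mk0 c hc, 1], ?_⟩
  funext ij
  simp [pluckerVec, plucker, Basis.unitsSMul_apply, Units.smul_def]
  ring

variable {r}

theorem smul_mem_pluckerCone {B : Set (ProjLine K N)} (c : K) (hc : c ≠ 0)
    (w : Fin (N + 1) × Fin (N + 1) → K) (hw : w ∈ pluckerCone B) : c • w ∈ pluckerCone B := by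
  obtain ⟨r, hr, b, rfl⟩ := hw
  obtain ⟨b', hb'⟩ := r.exists_basis_smul b hc
  exact ⟨r, hr, b', hb'.symm⟩

theorem mem_tangentLifts_iff {B : Set (ProjLine K N)} (b : Basis (Fin 2) K r.hat)
    {ℓ : r.hat →ₗ[K] (Fin (N + 1) → K)} : ℓ ∈ tangentLifts B r ↔
      r.pluckerDeriv b ℓ ∈ affineTangent (pluckerCone B) (r.pluckerVec b) := by
  refine ⟨fun h => h b, fun h b' => ?_⟩
  obtain ⟨c, hc, hvec, hderiv⟩ := r.exists_pluckerVec_eq_smul b b'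
  rw [← pluckerDeriv_apply, hvec, hderiv]
  exact smul_mem_affineTangent_smul (smul_mem_pluckerCone c hc) h

/-- The differential of the Plücker relations `(s ⌟ w) ∧ (t ⌟ w) = ⟨s ⌟ w, t⟩ w`. -/
theorem plucker_interiorProduct_of_mem_affineTangent {B : Set (ProjLine K N)}
    {w w' : Fin (N + 1) × Fin (N + 1) → K} (hw' : w' ∈ affineTangent (pluckerCone B) w)
    (s t : Fin (N + 1) → K) :
    plucker (interiorProduct s w') (interiorProduct t w) +
        plucker (interiorProduct s w) (interiorProduct t w') =
      (interiorProduct s w' ⬝ᵥ t) • w + (interiorProduct s w ⬝ᵥ t) • w' := by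
  let p (s : Fin (N + 1) → K) : Fin (N + 1) →
      MvPolynomial (Fin (N + 1) × Fin (N + 1)) K := interiorProduct (C ∘ s) X
  have heval : ∀ w s i, eval w (p s i) = interiorProduct s w i := by
    simp [p, interiorProduct]
  have hderiv : ∀ s i, eval w (mkDerivation K (fun ij => C (w' ij)) (p s i)) =
      interiorProduct s w' i := by
    simp [p, interiorProduct, Derivation.leibniz]
  funext ij
  let F := p s ij.1 * p t ij.2 - p s ij.2 * p t ij.1 - (∑ k, p s k * C (t k)) * X ij
  have hF : F ∈ vanishingIdeal K (pluckerCone B) := by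
    refine mem_vanishingIdeal_iff.mpr ?_
    rintro _ ⟨r, -, b, rfl⟩
    have h := congrFun (plucker_interiorProduct s t (b 0 : Fin (N + 1) → K) (b 1)) ij
    simpa [F, aeval_eq_eval, heval, sub_eq_zero, pluckerVec, plucker, dotProduct] using h
  have h := (eval_mkDerivation_C w w' F).trans (hw' F hF)
  simp only [F, map_sub, map_mul, map_sum, map_add, Derivation.leibniz, mkDerivation_X,
    derivation_C, smul_eq_mul, mul_zero, zero_add, hderiv, heval, eval_X, eval_C] at h
  simp only [Pi.add_apply, Pi.smul_apply, plucker, smul_eq_mul, dotProduct]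
  simp only [mul_comm (t _)] at h
  linear_combination h

theorem exists_pluckerDeriv_eq {B : Set (ProjLine K N)} (b : Basis (Fin 2) K r.hat)
    {w : Fin (N + 1) × Fin (N + 1) → K}
    (hw : w ∈ affineTangent (pluckerCone B) (r.pluckerVec b)) :
    ∃ ℓ ∈ tangentLifts B r, r.pluckerDeriv b ℓ = w := by
  obtain ⟨s, hs₀, hs₁⟩ := r.exists_dotProduct_eq b 1 0
  obtain ⟨t, ht₀, ht₁⟩ := r.exists_dotProduct_eq b 0 1
  have h := plucker_interiorProduct_of_mem_affineTangent hw s t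
  rw [interiorProduct_pluckerVec, interiorProduct_pluckerVec, hs₀, hs₁, ht₀, ht₁, neg_zero,
    zero_smul, zero_smul, one_smul, zero_add, add_zero, dotProduct_comm _ t, dotProduct_comm _ t,
    ht₁, one_smul] at h
  let ℓ : r.hat →ₗ[K] (Fin (N + 1) → K) := b.constr K
    ![-interiorProduct t w - (t ⬝ᵥ interiorProduct s w) • (b 0 : Fin (N + 1) → K),
      interiorProduct s w]
  have hℓ : r.pluckerDeriv b ℓ = w := by
    rw [pluckerDeriv_apply, b.constr_basis, b.constr_basis]
    refine (funext fun ij => ?_).trans (sub_eq_iff_eq_add'.mpr h)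
    simp [plucker, pluckerVec]
    ring
  exact ⟨ℓ, (mem_tangentLifts_iff b).mpr (hℓ ▸ hw), hℓ⟩

theorem map_pluckerDeriv_tangentLifts (B : Set (ProjLine K N)) (b : Basis (Fin 2) K r.hat) :
    (tangentLifts B r).map (r.pluckerDeriv b) =
      affineTangent (pluckerCone B) (r.pluckerVec b) := by
  refine le_antisymm ?_ fun w hw => exists_pluckerDeriv_eq b hw
  rintro _ ⟨ℓ, hℓ, rfl⟩
  exact (mem_tangentLifts_iff b).mp hℓ

/-- The lines at whose Plücker vectors `F` does not vanish. -/
def basicOpen (F : MvPolynomial (Fin (N + 1) × Fin (N + 1)) K) : Set (ProjLine K N) :=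
  {r | ∀ b : Basis (Fin 2) K r.hat, eval (r.pluckerVec b) F ≠ 0}

variable {B : Set (ProjLine K N)} {F : MvPolynomial (Fin (N + 1) × Fin (N + 1)) K} {d : ℕ}

theorem isOpen_basicOpen (hF : F.IsHomogeneous d) : IsOpen (basicOpen F) :=
  TopologicalSpace.isOpen_generateFrom_of_mem ⟨d, F, hF, rfl⟩

theorem mem_basicOpen (hF : F.IsHomogeneous d) {b : Basis (Fin 2) K r.hat}
    (h : eval (r.pluckerVec b) F ≠ 0) : r ∈ basicOpen F := by
  intro b'
  obtain ⟨c, hc, hb', -⟩ := r.exists_pluckerVec_eq_smul b b'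
  rw [hb', eval_smul_of_isHomogeneous hF]
  exact mul_ne_zero (pow_ne_zero _ hc) h

theorem nonempty_basicOpen_inter (hF : F.IsHomogeneous d)
    (h : F ∉ vanishingIdeal K (pluckerCone B)) : (basicOpen F ∩ B).Nonempty := by
  obtain ⟨_, ⟨r, hr, b, rfl⟩, hb⟩ := notMem_vanishingIdeal_iff.mp h
  exact ⟨r, mem_basicOpen hF hb, hr⟩

attribute [local instance] MvPolynomial.gradedAlgebra

theorem isHomogeneous_vanishingIdeal_pluckerCone [Infinite K] (B : Set (ProjLine K N)) :
    (vanishingIdeal K (pluckerCone B)).IsHomogeneous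
      (homogeneousSubmodule (Fin (N + 1) × Fin (N + 1)) K) := fun d F hF =>
  Set.mem_of_eq_of_mem (decomposition.decompose'_apply F d)
    (homogeneousComponent_mem_vanishingIdeal smul_mem_pluckerCone hF d)

theorem isPrime_vanishingIdeal_pluckerCone [Infinite K] (hB : IsIrreducible B) :
    (vanishingIdeal K (pluckerCone B)).IsPrime := by
  refine (isHomogeneous_vanishingIdeal_pluckerCone B).isPrime_of_homogeneous_mem_or_mem
    (fun htop => ?_) ?_
  · obtain ⟨r, hr⟩ := hB.nonempty
    obtain ⟨b⟩ := r.exists_basis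
    simpa using mem_vanishingIdeal_iff.mp ((Ideal.eq_top_iff_one _).mp htop) _ ⟨r, hr, b, rfl⟩
  · rintro F G ⟨d, hF⟩ ⟨e, hG⟩ hFG
    by_contra! h
    obtain ⟨r, hr, hrF, hrG⟩ := hB.2 _ _ (isOpen_basicOpen hF) (isOpen_basicOpen hG)
      (Set.inter_comm _ B ▸ nonempty_basicOpen_inter hF h.1)
      (Set.inter_comm _ B ▸ nonempty_basicOpen_inter hG h.2)
    obtain ⟨b⟩ := r.exists_basis
    refine mul_ne_zero (hrF b) (hrG b) ?_
    rw [← map_mul]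
    exact mem_vanishingIdeal_iff.mp hFG _ ⟨r, hr, b, rfl⟩

theorem ForGeneral.mono {P P' : ProjLine K N → Prop} (hP : ForGeneral B P)
    (h : ∀ r ∈ B, P r → P' r) : ForGeneral B P' :=
  hP.imp fun _ ⟨hU, hUB, hP⟩ => ⟨hU, hUB, fun r hr => h r hr.2 (hP r hr)⟩

theorem ForGeneral.and (hB : IsPreirreducible B) {P P' : ProjLine K N → Prop}
    (hP : ForGeneral B P) (hP' : ForGeneral B P') : ForGeneral B fun r => P r ∧ P' r := by
  obtain ⟨U, hU, hUB, hP⟩ := hP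
  obtain ⟨V, hV, hVB, hP'⟩ := hP'
  obtain ⟨r, hr, hrUV⟩ := hB U V hU hV (Set.inter_comm U B ▸ hUB) (Set.inter_comm V B ▸ hVB)
  exact ⟨U ∩ V, hU.inter hV, ⟨r, hrUV, hr⟩,
    fun r hr => ⟨hP r ⟨hr.1.1, hr.2⟩, hP' r ⟨hr.1.2, hr.2⟩⟩⟩

theorem ForGeneral.congr (hB : IsPreirreducible B) {P P' : ProjLine K N → Prop}
    (h : ForGeneral B fun r => P r ↔ P' r) : ForGeneral B P ↔ ForGeneral B P' :=
  ⟨fun hP => (h.and hB hP).mono fun _ _ h => h.1.mp h.2,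
    fun hP => (h.and hB hP).mono fun _ _ h => h.1.mpr h.2⟩

theorem forGeneral_of_eventually_generalPoints [Infinite K]
    [(vanishingIdeal K (pluckerCone B)).IsPrime] {P : (Fin (N + 1) × Fin (N + 1) → K) → Prop}
    (h : ∀ᶠ w in generalPoints (pluckerCone B), P w) :
    ForGeneral B fun r => ∃ b : Basis (Fin 2) K r.hat, P (r.pluckerVec b) := by
  obtain ⟨Q, hQ, h⟩ := eventually_generalPoints.mp h
  obtain ⟨d, hd⟩ : ∃ d, homogeneousComponent d Q ∉ vanishingIdeal K (pluckerCone B) := by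
    by_contra! hall
    exact hQ (sum_homogeneousComponent Q ▸ sum_mem fun d _ => hall d)
  have hhom := homogeneousComponent_isHomogeneous d Q
  refine ⟨basicOpen (homogeneousComponent d Q), isOpen_basicOpen hhom,
    nonempty_basicOpen_inter hhom hd, fun r ⟨hr, hrB⟩ => ?_⟩
  obtain ⟨b⟩ := r.exists_basis
  obtain ⟨c, hc, hQc⟩ : ∃ c : K, c ≠ 0 ∧ eval (c • r.pluckerVec b) Q ≠ 0 := by
    by_contra! hall
    exact hr b (eval_homogeneousComponent_eq_zero hall d)
  obtain ⟨b', hb'⟩ := r.exists_basis_smul b hc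
  exact ⟨b', h _ ⟨r, hrB, b', rfl⟩ (hb' ▸ hQc)⟩

end ProjLine

section Contraction

variable {K : Type*} [Field K] {N : ℕ}

/-- The coordinates of the interior product `s ⌟ w`, as polynomials in `s` and `w`. -/
def contraction : Fin (N + 1) → MvPolynomial (Fin (N + 1) ⊕ Fin (N + 1) × Fin (N + 1)) K :=
  interiorProduct (X ∘ Sum.inl) (X ∘ Sum.inr)

theorem eval_contraction (p : Fin (N + 1) ⊕ Fin (N + 1) × Fin (N + 1) → K) :
    (fun i => eval p (contraction i)) = interiorProduct (p ∘ Sum.inl) (p ∘ Sum.inr) := by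
  funext i
  simp [contraction, interiorProduct]

theorem jacobian_contraction_mulVec (p v : Fin (N + 1) ⊕ Fin (N + 1) × Fin (N + 1) → K) :
    (jacobian (contraction (K := K)) p).mulVec v = interiorProduct (v ∘ Sum.inl) (p ∘ Sum.inr) +
      interiorProduct (p ∘ Sum.inl) (v ∘ Sum.inr) := by
  rw [jacobian_mulVec]
  funext i
  simp only [contraction, interiorProduct, Function.comp_apply, map_sum, Derivation.leibniz,
    mkDerivation_X, smul_eq_mul, map_add, map_mul, eval_X, eval_C, Pi.add_apply,
    Finset.sum_add_distrib]
  rw [add_comm]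
  exact congrArg (· + _) (Finset.sum_congr rfl fun _ _ => mul_comm _ _)

end Contraction

namespace ProjLine

variable {K : Type*} [Field K] {N : ℕ} {B : Set (ProjLine K N)} {r : ProjLine K N}

theorem eval_contraction_mem_unionCone (p : Fin (N + 1) ⊕ Fin (N + 1) × Fin (N + 1) → K)
    (hp : p ∈ affineProd Set.univ (pluckerCone B)) :
    (fun i => eval p (contraction i)) ∈ unionCone B := by
  obtain ⟨-, r, hr, b, hw⟩ := hp
  rw [eval_contraction, hw, ← coe_sweep]
  exact ⟨r, hr, Subtype.prop _⟩

theorem mem_vanishingIdeal_unionCone_of_bind₁_contraction (F : MvPolynomial (Fin (N + 1)) K)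
    (hF : bind₁ contraction F ∈ vanishingIdeal K (affineProd Set.univ (pluckerCone B))) :
    F ∈ vanishingIdeal K (unionCone B) := by
  refine mem_vanishingIdeal_iff.mpr ?_
  rintro x ⟨r, hr, hx⟩
  obtain ⟨b⟩ := r.exists_basis
  obtain ⟨s, hs⟩ := r.sweep_surjective b ⟨x, hx⟩
  have h : eval (Sum.elim s (r.pluckerVec b)) (bind₁ contraction F) = 0 :=
    mem_vanishingIdeal_iff.mp hF _ ⟨trivial, r, hr, b, rfl⟩
  rwa [eval_bind₁, eval_contraction, Sum.elim_comp_inl, Sum.elim_comp_inr, ← coe_sweep, hs] at h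

/-- The subspace of `V` spanned by `r̂` and the values at `x` of the tangent vectors to `B` at
`r`: the image of the differential of the incidence map `(x, r) ↦ x`. -/
def sweptTangent (B : Set (ProjLine K N)) (r : ProjLine K N) (x : r.hat) :
    Submodule K (Fin (N + 1) → K) :=
  ((tangentSpace B r).map (LinearMap.applyₗ x)).comap r.hat.mkQ

theorem mem_sweptTangent {x : r.hat} {y : Fin (N + 1) → K} :
    y ∈ sweptTangent B r x ↔ ∃ ℓ ∈ tangentLifts B r, y - ℓ x ∈ r.hat := by
  simp only [sweptTangent, tangentSpace, Submodule.mem_comap, Submodule.mem_map,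
    exists_exists_and_eq_and]
  refine exists_congr fun ℓ => and_congr_right fun _ => ?_
  rw [eq_comm, ← sub_eq_zero, ← Submodule.Quotient.mk_eq_zero]
  rfl

theorem map_jacobian_contraction [Infinite K] (hr : r ∈ B) (b : Basis (Fin 2) K r.hat)
    (s : Fin (N + 1) → K) :
    (affineTangent (affineProd Set.univ (pluckerCone B)) (Sum.elim s (r.pluckerVec b))).map
      (jacobian (contraction (K := K)) (Sum.elim s (r.pluckerVec b))).mulVecLin =
        sweptTangent B r (r.sweep b s) := by
  have hmem : Sum.elim s (r.pluckerVec b) ∈ affineProd Set.univ (pluckerCone B) :=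
    ⟨trivial, r, hr, b, rfl⟩
  have hsweep : ∀ s', interiorProduct s' (r.pluckerVec b) ∈ r.hat := fun s' =>
    r.coe_sweep b s' ▸ Subtype.prop _
  ext y
  rw [mem_sweptTangent, Submodule.mem_map]
  simp only [Matrix.mulVecLin_apply, jacobian_contraction_mulVec, Sum.elim_comp_inl,
    Sum.elim_comp_inr, mem_affineTangent_affineProd hmem, affineTangent_univ, Submodule.mem_top,
    true_and]
  constructor
  · rintro ⟨v, hv, rfl⟩
    obtain ⟨ℓ, hℓ, hw⟩ := exists_pluckerDeriv_eq b hv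
    refine ⟨ℓ, hℓ, ?_⟩
    rw [add_sub_assoc, ← hw]
    exact add_mem (hsweep _) (r.interiorProduct_pluckerDeriv b ℓ s)
  · rintro ⟨ℓ, hℓ, hy⟩
    obtain ⟨s', hs'⟩ := r.sweep_surjective b
      ⟨_, sub_mem hy (r.interiorProduct_pluckerDeriv b ℓ s)⟩
    refine ⟨Sum.elim s' (r.pluckerDeriv b ℓ), (mem_tangentLifts_iff b).mp hℓ, ?_⟩
    rw [Sum.elim_comp_inl, Sum.elim_comp_inr, ← coe_sweep, hs']
    simp

theorem finrank_sweptTangent (B : Set (ProjLine K N)) (x : r.hat) :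
    finrank K (sweptTangent B r x) =
      finrank K ((tangentSpace B r).map (LinearMap.applyₗ x)) + 2 := by
  rw [sweptTangent, finrank_comap_mkQ, r.finrank_hat]

/-- The inclusion of `r̂` in `V` is a lift of `0 ∈ T_r 𝔾(1,N)`, but it moves the Plücker vector
along itself. -/
theorem finrank_tangentSpace_lt [CharZero K] (hr : r ∈ B) (b : Basis (Fin 2) K r.hat) :
    finrank K (tangentSpace B r) <
      finrank K (affineTangent (pluckerCone B) (r.pluckerVec b)) := by
  have hker : tangentLifts B r ⊓ LinearMap.ker (r.pluckerDeriv b) <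
      tangentLifts B r ⊓ LinearMap.ker (LinearMap.compRight K r.hat.mkQ) := by
    have hw : r.pluckerDeriv b r.hat.subtype = (2 : K) • r.pluckerVec b :=
      (two_smul K (r.pluckerVec b)).symm
    refine lt_of_le_of_ne (inf_le_inf_left _ fun ℓ hℓ => LinearMap.ext fun x => ?_) fun h => ?_
    · obtain ⟨s, rfl⟩ := r.sweep_surjective b x
      have h := r.interiorProduct_pluckerDeriv b ℓ s
      rw [LinearMap.mem_ker.mp hℓ, interiorProduct_zero, zero_sub, neg_mem_iff] at h
      exact (Submodule.Quotient.mk_eq_zero _).mpr h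
    · have hmem : r.hat.subtype ∈
          tangentLifts B r ⊓ LinearMap.ker (LinearMap.compRight K r.hat.mkQ) := by
        refine ⟨(mem_tangentLifts_iff b).mpr (hw ▸ Submodule.smul_mem _ 2
          (self_mem_affineTangent smul_mem_pluckerCone ⟨r, hr, b, rfl⟩)), LinearMap.ext fun x => ?_⟩
        exact (Submodule.Quotient.mk_eq_zero _).mpr x.2
      rw [← h] at hmem
      exact smul_ne_zero two_ne_zero (r.pluckerVec_ne_zero b) (hw ▸ LinearMap.mem_ker.mp hmem.2)
  have hT : finrank K (tangentSpace B r) + _ = finrank K (tangentLifts B r) :=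
    finrank_map_add_finrank_inf_ker (LinearMap.compRight K r.hat.mkQ) _
  have hw := finrank_map_add_finrank_inf_ker (r.pluckerDeriv b) (tangentLifts B r)
  rw [map_pluckerDeriv_tangentLifts] at hw
  have := Submodule.finrank_lt_finrank_of_lt hker
  omega

/-- The filter of nonempty Zariski open subsets of the plane `r̂`, as the image of that of the space
of covectors. -/
def generalVectors (b : Basis (Fin 2) K r.hat) : Filter r.hat :=
  (generalPoints Set.univ).map (r.sweep b)

theorem eventually_generalVectors {b : Basis (Fin 2) K r.hat} {P : r.hat → Prop} :
    (∀ᶠ x in generalVectors b, P x) ↔ ∀ᶠ s in generalPoints Set.univ, P (r.sweep b s) :=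
  eventually_map

instance generalVectors_neBot [Infinite K] (b : Basis (Fin 2) K r.hat) :
    (generalVectors b).NeBot :=
  map_neBot

theorem eventually_apply_ne_zero [Infinite K] (b : Basis (Fin 2) K r.hat) {f : r.hat →ₗ[K] K}
    (hf : f ≠ 0) : ∀ᶠ x in generalVectors b, f x ≠ 0 := by
  let Q : MvPolynomial (Fin (N + 1)) K :=
    -(∑ j, X j * C ((b 1 : Fin (N + 1) → K) j)) * C (f (b 0)) +
      (∑ j, X j * C ((b 0 : Fin (N + 1) → K) j)) * C (f (b 1))
  have hQ : ∀ s, eval s Q = f (r.sweep b s) := fun s => by simp [Q, sweep, dotProduct]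
  obtain ⟨x, hx⟩ := DFunLike.ne_iff.mp hf
  obtain ⟨s, rfl⟩ := r.sweep_surjective b x
  refine eventually_generalVectors.mpr ?_
  filter_upwards [eventually_generalPoints_eval_ne_zero
    (notMem_vanishingIdeal_iff.mpr ⟨s, Set.mem_univ s, (hQ s).trans_ne hx⟩)] with s hs
  rwa [hQ] at hs

theorem eventually_notMem_span_singleton [Infinite K] (b : Basis (Fin 2) K r.hat) (x₀ : r.hat) :
    ∀ᶠ x in generalVectors b, x ∉ Submodule.span K {x₀} := by
  have hlt : Submodule.span K {x₀} < ⊤ := lt_top_iff_ne_top.mpr fun htop => by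
    have h := finrank_span_le_card (R := K) ({x₀} : Set r.hat)
    rw [htop, finrank_top, r.finrank_hat] at h
    simp at h
  obtain ⟨f, hf, hspan⟩ := Submodule.exists_le_ker_of_lt_top _ hlt
  filter_upwards [eventually_apply_ne_zero b hf] with x hx hmem using hx (hspan hmem)

theorem mem_fixedTangent {y : Fin (N + 1) → K} : y ∈ fixedTangent B r ↔
    ∀ x ∈ r.hat, x ≠ 0 → y ∈ affineTangent (unionCone B) x := by
  simp [fixedTangent, Submodule.mem_iInf, and_imp]

theorem mem_fixedTangent_iff_eventually [Infinite K] (b : Basis (Fin 2) K r.hat)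
    {y : Fin (N + 1) → K} : y ∈ fixedTangent B r ↔
      ∀ᶠ x : r.hat in generalVectors b, y ∈ affineTangent (unionCone B) (x : Fin (N + 1) → K) := by
  rw [mem_fixedTangent]
  refine ⟨fun hy => ?_, fun hy x hx _ F hF => ?_⟩
  · filter_upwards [eventually_notMem_span_singleton b 0] with x hx
    refine hy x x.2 fun h0 => hx ?_
    rw [Submodule.coe_eq_zero.mp h0]
    exact zero_mem _
  · let φ : Fin (N + 1) → MvPolynomial (Fin (N + 1)) K :=
      interiorProduct X (C ∘ r.pluckerVec b)
    have heval : ∀ s, eval s (∑ i, bind₁ φ (pderiv i F) * C (y i)) =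
        ∑ i, eval (r.sweep b s : Fin (N + 1) → K) (pderiv i F) * y i := fun s => by
      have hs : (fun i => eval s (φ i)) = r.sweep b s := by
        rw [coe_sweep]
        funext i
        simp [φ, interiorProduct]
      simp only [map_sum, map_mul, eval_bind₁, eval_C, hs]
    obtain ⟨s, hs⟩ := r.sweep_surjective b ⟨x, hx⟩
    rw [← show (r.sweep b s : Fin (N + 1) → K) = x by rw [hs], ← heval]
    refine mem_vanishingIdeal_iff.mp (mem_vanishingIdeal_of_eventually ?_) s (Set.mem_univ s)
    filter_upwards [eventually_generalVectors.mp hy] with s hs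
    rw [heval]
    exact hs F hF

theorem fixedTangent_eq_comap_fixedSpace [Infinite K] (b : Basis (Fin 2) K r.hat)
    (h : ∀ᶠ x : r.hat in generalVectors b,
      affineTangent (unionCone B) (x : Fin (N + 1) → K) = sweptTangent B r x) :
    fixedTangent B r =
      (fixedSpace (tangentSpace B r) (generalVectors b)).comap r.hat.mkQ := by
  ext y
  rw [mem_fixedTangent_iff_eventually b, Submodule.mem_comap, mem_fixedSpace]
  refine eventually_congr (h.mono fun x hx => ?_)
  rw [hx, sweptTangent, Submodule.mem_comap]

theorem hasFocalLength_iff_finrank_fixedTangent [IsAlgClosed K] [CharZero K] (hr : r ∈ B)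
    (b : Basis (Fin 2) K r.hat) {n : ℕ}
    (hB : finrank K (affineTangent (pluckerCone B) (r.pluckerVec b)) = n + 1)
    (hX : ∀ᶠ x : r.hat in generalVectors b,
      finrank K (affineTangent (unionCone B) (x : Fin (N + 1) → K)) = n + 2)
    (hswept : ∀ᶠ x : r.hat in generalVectors b,
      affineTangent (unionCone B) (x : Fin (N + 1) → K) = sweptTangent B r x) (k : ℕ) :
    HasFocalLength B r k ↔ finrank K (fixedTangent B r) = k + 2 := by
  have hinj : ∀ᶠ x in generalVectors b,
      Function.Injective ((LinearMap.applyₗ x).domRestrict (tangentSpace B r)) := by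
    filter_upwards [hX, hswept] with x hx hxs
    refine injective_domRestrict_of_finrank_le ?_
    have hT := finrank_tangentSpace_lt hr b
    rw [hxs, finrank_sweptTangent] at hx
    omega
  rw [hasFocalLength_iff_finrank_fixedSpace (eventually_notMem_span_singleton b) hinj,
    fixedTangent_eq_comap_fixedSpace b hswept, finrank_comap_mkQ, r.finrank_hat,
    Nat.add_right_cancel_iff]

theorem eventually_affineTangent_unionCone [CharZero K]
    [(vanishingIdeal K (pluckerCone B)).IsPrime] {d : ℕ}
    (hX : Algebra.trdeg K (MvPolynomial (Fin (N + 1)) K ⧸ vanishingIdeal K (unionCone B)) = d) :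
    ∀ᶠ w in generalPoints (pluckerCone B), ∀ᶠ s in generalPoints Set.univ,
      finrank K (affineTangent (unionCone B) (interiorProduct s w)) = d ∧
        (affineTangent (affineProd Set.univ (pluckerCone B)) (Sum.elim s w)).map
          (jacobian (contraction (K := K)) (Sum.elim s w)).mulVecLin =
            affineTangent (unionCone B) (interiorProduct s w) := by
  have := isPrime_vanishingIdeal_of_dominant eval_contraction_mem_unionCone
    (mem_vanishingIdeal_unionCone_of_bind₁_contraction (B := B))
  have hfinrank := (tendsto_generalPoints eval_contraction_mem_unionCone
    (mem_vanishingIdeal_unionCone_of_bind₁_contraction (B := B))).eventually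
      (eventually_finrank_affineTangent hX)
  have hmap := eventually_map_affineTangent_eq eval_contraction_mem_unionCone
    (mem_vanishingIdeal_unionCone_of_bind₁_contraction (B := B))
  filter_upwards [eventually_eventually_generalPoints (hfinrank.and hmap)] with w hw
  filter_upwards [hw] with s hs
  rwa [eval_contraction, Sum.elim_comp_inl, Sum.elim_comp_inr] at hs

theorem forGeneral_hasFocalLength_iff [IsAlgClosed K] [CharZero K] (hB : IsIrreducible B) {n : ℕ}
    (hB_dim : HasProjectiveDim K (pluckerCone B) n)
    (hX_dim : HasProjectiveDim K (unionCone B) (n + 1)) (k : ℕ) :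
    ForGeneral B fun r => HasFocalLength B r k ↔ finrank K (fixedTangent B r) = k + 2 := by
  have := isPrime_vanishingIdeal_pluckerCone hB
  refine (forGeneral_of_eventually_generalPoints
    ((eventually_finrank_affineTangent hB_dim).and
      (eventually_affineTangent_unionCone hX_dim))).mono ?_
  rintro r hr ⟨b, hw, hx⟩
  have hx' : ∀ᶠ x : r.hat in generalVectors b,
      finrank K (affineTangent (unionCone B) (x : Fin (N + 1) → K)) = n + 2 ∧
        affineTangent (unionCone B) (x : Fin (N + 1) → K) = sweptTangent B r x := by
    refine eventually_generalVectors.mpr (hx.mono fun s hs => ?_)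
    rw [map_jacobian_contraction hr, ← coe_sweep] at hs
    exact ⟨hs.1, hs.2.symm⟩
  exact hasFocalLength_iff_finrank_fixedTangent hr b hw (hx'.mono fun _ h => h.1)
    (hx'.mono fun _ h => h.2) k

end ProjLine

end

theorem theorem0p1_general {K : Type*} [Field K] [IsAlgClosed K] [CharZero K] {N n : ℕ}
    {B : Set (ProjLine K N)} (hB_irred : IsIrreducible B)
    (hB_dim : HasProjectiveDim K (ProjLine.pluckerCone B) n)
    (hX_dim : HasProjectiveDim K (ProjLine.unionCone B) (n + 1)) (k : ℕ) :
    ProjLine.ForGeneral B (fun r => ProjLine.HasFocalLength B r k) ↔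
      ProjLine.ForGeneral B (fun r => finrank K (ProjLine.fixedTangent B r) = k + 2) :=
  ProjLine.ForGeneral.congr hB_irred.2
    (ProjLine.forGeneral_hasFocalLength_iff hB_irred hB_dim hX_dim k)

theorem theorem0p1 {K : Type*} [Field K] [IsAlgClosed K] [CharZero K] (N n : ℕ) (hn : n + 2 ≤ N)
    (B : Set (ProjLine K N)) (hB_closed : IsClosed B) (hB_irred : IsIrreducible B)
    (hB_dim : HasProjectiveDim K (ProjLine.pluckerCone B) n)
    (hX_dim : HasProjectiveDim K (ProjLine.unionCone B) (n + 1))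
    (k : ℕ) (hk : k ≤ n) :
    ProjLine.ForGeneral B (fun r => ProjLine.HasFocalLength B r k) ↔
      ProjLine.ForGeneral B
        (fun r => Module.finrank K (ProjLine.fixedTangent B r) = k + 2) :=
  theorem0p1_general hB_irred hB_dim hX_dim k
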